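/- **Theorem 2.9.** Let $\alpha\in(1,2)$. Let $L=(L_t)_{t\ge0}$ be the spectrally positive $\alpha$-stable Lévy process with $\mathbb E[e^{-\lambda L_t}]=e^{t\lambda^\alpha}$ for $\lambda\ge 0$, and let $p$ be the continuous density of $L_1$. Let $(\sigma_t)_{t\ge0}$ be an increasing (càdlàg) Lévy process started at $0$ with $\mathbb E[e^{-\lambda\sigma_t}]=e^{-t\alpha\lambda^{\alpha-1}}$ for $\lambda\ge0$, and let $$M_t=\exp\Big(\int_0^t\sigma_s\,ds\Big)\frac{p(-\sigma_t)}{p(0)}.$$ Let $\widetilde\sigma=(\widetilde\sigma_t)_{t\ge0}$ be a càdlàg process such that $\mathbb E[F((\widetilde\sigma_s)_{s\le t})]=\mathbb E[M_tF((\sigma_s)_{s\le t})]$ for every $t\ge0$ and every bounded measurable functional $F$ of paths on $[0,t]$. Conditionally given $\widetilde\sigma$, let $Y_1<Y_2<\cdots$ be the points of a Poisson process on $[0,\infty)$ with intensity $\widetilde\sigma_t\,dt$. Let $U_1,U_2,\dots$ be i.i.d. uniform on $[0,1]$, independent of $(\widetilde\sigma,(Y_k)_{k\ge1})$, and set $Z_k=\inf\{t>0:\widetilde\sigma_t>U_k\,\widetilde\sigma_{Y_k-}\}$.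 Given sequences $(y_k)_{k\ge1}$, $(z_k)_{k\ge1}$ in $[0,\infty)$ with $(y_k)$ strictly increasing to $\infty$ and $z_k<y_k$ for all $k$, put $y_0=z_0=0$. Let $d_0$ be the trivial metric on $\{0\}$ and define inductively the metric $d_k$ on $[0,y_k]$ for $k\ge 1$ by $d_k(u,u)=0$ and, for $u<v$, $$d_k(u,v)=d_k(v,u)=\begin{cases}d_{k-1}(u,v)& u,v\le y_{k-1},\\ d_{k-1}(u,z_{k-1})+|v-y_{k-1}|& u\le y_{k-1}<v,\\ |v-u|& u,v>y_{k-1}.\end{cases}$$ Let $(\mathcal T,d)$ be the completion of $[0,\infty)$ for the common extension $d$ of all the $d_k$. Then, almost surely, the sequences $(Y_k)_{k\ge1}$ and $(Z_k)_{k\ge1}$ satisfy the above requirements, and the $\mathbb R$-tree $(\mathcal T,d)$ constructed from them is compact. -/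

import Mathlib

open MeasureTheory ProbabilityTheory
open scoped NNReal ENNReal

noncomputable section

namespace LineBreaking

/-! ### The deterministic line-breaking construction

The sequences are indexed from `0`: `y k` and `z k` are the cut point and the attachment point
number `k + 1`. -/

/-- `y` is a strictly increasing sequence of cut points in `[0, ∞)` tending to infinity, and each
attachment point lies strictly before the corresponding cut point. -/
structure IsCutAttach (y z : ℕ → ℝ≥0) : Prop where
  strictMono : StrictMono y
  tendsto : Filter.Tendsto y Filter.atTop Filter.atTop
  lt : ∀ k, z k < y k

/-- Prepend the value `0` to a sequence: the initial segment starts at `0`, and the first cut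
point has index `1`. -/
def consZero (x : ℕ → ℝ≥0) : ℕ → ℝ≥0
  | 0 => 0
  | k + 1 => x k

/-- The metrics `d_k`, of which only the values on `[0, y_k]` matter (where `y_0 = z_0 = 0`):
`d_0` is trivial, and `d_{k+1}` is obtained from `d_k` by gluing the open end of the segment
`(y_k, y_{k+1}]` at the point `z_k`. -/
def gluedDist (y z : ℕ → ℝ≥0) : ℕ → ℝ≥0 → ℝ≥0 → ℝ
  | 0, _, _ => 0
  | k + 1, u, v =>
    if u ≤ consZero y k then
      if v ≤ consZero y k then gluedDist y z k u v
      else gluedDist y z k u (consZero z k) + |(v : ℝ) - consZero y k|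
    else
      if v ≤ consZero y k then gluedDist y z k v (consZero z k) + |(u : ℝ) - consZero y k|
      else |(v : ℝ) - u|

/-- The common extension `d` of all the metrics `d_k` to `[0, ∞)`, computed at `u, v` with the
first `k` such that `u, v ≤ y_k`. -/
def lineDist (y z : ℕ → ℝ≥0) (u v : ℝ≥0) : ℝ :=
  gluedDist y z (sInf {k | u ≤ consZero y k ∧ v ≤ consZero y k}) u v

section Lemmas

variable {y z : ℕ → ℝ≥0}

theorem consZero_strictMono (h : IsCutAttach y z) : StrictMono (consZero y) := by
  refine strictMono_nat_of_lt_succ fun k => ?_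
  cases k with
  | zero => exact lt_of_le_of_lt (zero_le : (0 : ℝ≥0) ≤ z 0) (h.lt 0)
  | succ k => exact h.strictMono (Nat.lt_succ_self k)

theorem exists_le_consZero (h : IsCutAttach y z) (u : ℝ≥0) : ∃ k, u ≤ consZero y k := by
  obtain ⟨k, hk⟩ := (h.tendsto.eventually (Filter.eventually_ge_atTop u)).exists
  exact ⟨k + 1, hk⟩

theorem gluedDist_succ_of_le {k : ℕ} {u v : ℝ≥0} (hu : u ≤ consZero y k)
    (hv : v ≤ consZero y k) : gluedDist y z (k + 1) u v = gluedDist y z k u v := by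
  simp [gluedDist, hu, hv]

theorem gluedDist_eq_of_le (h : IsCutAttach y z) {k m : ℕ} (hkm : k ≤ m) {u v : ℝ≥0}
    (hu : u ≤ consZero y k) (hv : v ≤ consZero y k) :
    gluedDist y z m u v = gluedDist y z k u v := by
  induction m, hkm using Nat.le_induction with
  | base => rfl
  | succ m hkm ih =>
    have hm := (consZero_strictMono h).monotone hkm
    rw [gluedDist_succ_of_le (hu.trans hm) (hv.trans hm), ih]

/-- `lineDist` agrees with every `d_k` on `[0, y_k]`. -/
theorem lineDist_eq (h : IsCutAttach y z) {k : ℕ} {u v : ℝ≥0}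
    (hu : u ≤ consZero y k) (hv : v ≤ consZero y k) :
    lineDist y z u v = gluedDist y z k u v := by
  have hmem : k ∈ {k | u ≤ consZero y k ∧ v ≤ consZero y k} := ⟨hu, hv⟩
  have hs := Nat.sInf_mem ⟨k, hmem⟩
  exact (gluedDist_eq_of_le h (Nat.sInf_le hmem) hs.1 hs.2).symm

theorem gluedDist_self (k : ℕ) (u : ℝ≥0) : gluedDist y z k u u = 0 := by
  induction k with
  | zero => rfl
  | succ k ih => by_cases hu : u ≤ consZero y k <;> simp [gluedDist, hu, ih]

theorem gluedDist_comm (k : ℕ) (u v : ℝ≥0) : gluedDist y z k u v = gluedDist y z k v u := by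
  induction k generalizing u v with
  | zero => rfl
  | succ k ih =>
    by_cases hu : u ≤ consZero y k <;> by_cases hv : v ≤ consZero y k <;>
      simp [gluedDist, hu, hv, ih u v, abs_sub_comm]

theorem gluedDist_nonneg (k : ℕ) (u v : ℝ≥0) : 0 ≤ gluedDist y z k u v := by
  induction k generalizing u v with
  | zero => exact le_rfl
  | succ k ih =>
    have h1 := ih u v
    have h2 := ih u (consZero z k)
    have h3 := ih v (consZero z k)
    by_cases hu : u ≤ consZero y k <;> by_cases hv : v ≤ consZero y k <;>
      simp only [gluedDist, hu, hv, if_true, if_false] <;> positivity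

theorem gluedDist_triangle (k : ℕ) (u v w : ℝ≥0) :
    gluedDist y z k u w ≤ gluedDist y z k u v + gluedDist y z k v w := by
  induction k generalizing u v w with
  | zero => simp [gluedDist]
  | succ k ih =>
    have h1 := ih u v w
    have h2 := ih u v (consZero z k)
    have h3 := ih w v (consZero z k)
    have h4 := ih u (consZero z k) w
    have c1 := gluedDist_comm (y := y) (z := z) k w v
    have c2 := gluedDist_comm (y := y) (z := z) k w (consZero z k)
    have n1 := gluedDist_nonneg (y := y) (z := z) k v (consZero z k)
    have a0 := abs_nonneg ((v : ℝ) - consZero y k)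
    have a1 := abs_sub_le (w : ℝ) v u
    have a2 := abs_sub_le (w : ℝ) v (consZero y k)
    have a3 := abs_sub_le (u : ℝ) v (consZero y k)
    have a4 := abs_sub_comm (u : ℝ) v
    have a5 := abs_sub_le (w : ℝ) (consZero y k) u
    have a6 := abs_sub_comm (u : ℝ) (consZero y k)
    by_cases hu : u ≤ consZero y k <;> by_cases hv : v ≤ consZero y k <;>
      by_cases hw : w ≤ consZero y k <;>
      simp only [gluedDist, hu, hv, hw, if_true, if_false] <;> linarith

theorem eq_of_gluedDist_eq_zero (k : ℕ) {u v : ℝ≥0}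
    (hu : u ≤ consZero y k) (hv : v ≤ consZero y k) (huv : gluedDist y z k u v = 0) :
    u = v := by
  induction k generalizing u v with
  | zero => exact (le_antisymm hu zero_le).trans (le_antisymm hv zero_le).symm
  | succ k ih =>
    have n1 := gluedDist_nonneg (y := y) (z := z) k u (consZero z k)
    have n2 := gluedDist_nonneg (y := y) (z := z) k v (consZero z k)
    by_cases hu' : u ≤ consZero y k <;> by_cases hv' : v ≤ consZero y k <;>
      simp only [gluedDist, hu', hv', if_true, if_false] at huv
    · exact ih hu' hv' huv
    · have : 0 < |(v : ℝ) - consZero y k| :=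
        abs_pos.2 (sub_ne_zero.2 (by exact_mod_cast (not_le.1 hv').ne'))
      linarith
    · have : 0 < |(u : ℝ) - consZero y k| :=
        abs_pos.2 (sub_ne_zero.2 (by exact_mod_cast (not_le.1 hu').ne'))
      linarith
    · exact_mod_cast (sub_eq_zero.1 (abs_eq_zero.1 huv)).symm

theorem exists_three_le (h : IsCutAttach y z) (u v w : ℝ≥0) :
    ∃ k, u ≤ consZero y k ∧ v ≤ consZero y k ∧ w ≤ consZero y k := by
  obtain ⟨k, hk⟩ := exists_le_consZero h (max u (max v w))
  exact ⟨k, (le_max_left _ _).trans hk, ((le_max_left _ _).trans (le_max_right _ _)).trans hk,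
    ((le_max_right _ _).trans (le_max_right _ _)).trans hk⟩

theorem lineDist_comm (h : IsCutAttach y z) (u v : ℝ≥0) :
    lineDist y z u v = lineDist y z v u := by
  obtain ⟨k, hu, hv, -⟩ := exists_three_le h u v u
  rw [lineDist_eq h hu hv, lineDist_eq h hv hu, gluedDist_comm]

theorem lineDist_triangle (h : IsCutAttach y z) (u v w : ℝ≥0) :
    lineDist y z u w ≤ lineDist y z u v + lineDist y z v w := by
  obtain ⟨k, hu, hv, hw⟩ := exists_three_le h u v w
  rw [lineDist_eq h hu hv, lineDist_eq h hv hw, lineDist_eq h hu hw]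
  exact gluedDist_triangle k u v w

theorem eq_of_lineDist_eq_zero (h : IsCutAttach y z) {u v : ℝ≥0}
    (huv : lineDist y z u v = 0) : u = v := by
  obtain ⟨k, hu, hv, -⟩ := exists_three_le h u v u
  rw [lineDist_eq h hu hv] at huv
  exact eq_of_gluedDist_eq_zero k hu hv huv

end Lemmas

/-- The half-line `[0, ∞)`, to be equipped with the line-breaking metric. -/
def PreTree {y z : ℕ → ℝ≥0} (_ : IsCutAttach y z) : Type := ℝ≥0

instance {y z : ℕ → ℝ≥0} (h : IsCutAttach y z) : MetricSpace (PreTree h) where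
  dist u v := lineDist y z u v
  dist_self u := gluedDist_self _ _
  dist_comm u v := lineDist_comm h u v
  dist_triangle u v w := lineDist_triangle h u v w
  eq_of_dist_eq_zero {u v} huv := eq_of_lineDist_eq_zero h (u := u) (v := v) huv

/-- The tree produced by the line-breaking construction: the metric completion of `[0, ∞)` for
the line-breaking metric. -/
abbrev Tree {y z : ℕ → ℝ≥0} (h : IsCutAttach y z) : Type := UniformSpace.Completion (PreTree h)

/-! ### The random line-breaking construction -/

/-- Lebesgue measure on `[0, ∞)`. -/
def lebesgue : Measure ℝ≥0 := Measure.comap ((↑) : ℝ≥0 → ℝ) volume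

/-- Right-continuous with left limits. -/
def IsCadlag (f : ℝ≥0 → ℝ) : Prop :=
  ∀ t, ContinuousWithinAt f (Set.Ici t) t ∧
    ∃ l, Filter.Tendsto f (nhdsWithin t (Set.Iio t)) (nhds l)

/-- Conditionally given the process `τ`, the random variables `Y 0 < Y 1 < ⋯` are the points, in
increasing order, of a Poisson process on `[0, ∞)` with intensity `τ_t dt`: given `τ`, the numbers
of points in disjoint bounded Borel sets `B i` are independent Poisson variables with parameters
`∫_{B i} τ_s ds`. The conditional law is expressed by integration over the events `{τ ∈ A}`. -/
structure IsCoxPoints {Ω : Type*} [MeasurableSpace Ω] (τ : ℝ≥0 → Ω → ℝ) (Y : ℕ → Ω → ℝ≥0)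
    (P : Measure Ω) : Prop where
  measurable : ∀ k, Measurable (Y k)
  strictMono : ∀ᵐ ω ∂P, StrictMono (fun k => Y k ω)
  count : ∀ A : Set (ℝ≥0 → ℝ), MeasurableSet A →
    ∀ (n : ℕ) (B : Fin n → Set ℝ≥0), (∀ i, MeasurableSet (B i)) → (∀ i, BddAbove (B i)) →
    Pairwise (fun i j => Disjoint (B i) (B j)) → ∀ m : Fin n → ℕ,
      P {ω | (fun t => τ t ω) ∈ A ∧ ∀ i, {k | Y k ω ∈ B i}.encard = m i} =
        ∫⁻ ω in {ω | (fun t => τ t ω) ∈ A},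
          ∏ i, poissonMeasure (∫ s in B i, τ s ω ∂lebesgue).toNNReal {m i} ∂P

/-- The randomness used by the line-breaking construction with intensity process `τ`: the cut
points `Y`, a Cox process driven by `τ`, and i.i.d. uniform variables `U`, independent of
`(τ, Y)`. -/
structure IsLineBreakingInput {Ω : Type*} [MeasurableSpace Ω] (τ : ℝ≥0 → Ω → ℝ)
    (Y : ℕ → Ω → ℝ≥0) (U : ℕ → Ω → ℝ) (P : Measure Ω) : Prop where
  cuts : IsCoxPoints τ Y P
  measurable_unif : ∀ k, Measurable (U k)
  law_unif : ∀ k, P.map (U k) = volume.restrict (Set.Icc (0 : ℝ) 1)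
  indep_unif : iIndepFun U P
  indep : IndepFun (fun ω k => U k ω) (fun ω => ((fun t => τ t ω), (fun k => Y k ω))) P

/-- The attachment point `inf {t > 0 : τ_t > U_k τ_{Y_k-}}` of the cut point `Y_k`. -/
def attach {Ω : Type*} (τ : ℝ≥0 → Ω → ℝ) (Y : ℕ → Ω → ℝ≥0) (U : ℕ → Ω → ℝ) (k : ℕ) (ω : Ω) :
    ℝ≥0 :=
  sInf {t | 0 < t ∧ U k ω * Function.leftLim (fun s => τ s ω) (Y k ω) < τ t ω}

/-! ### The intensity process -/

/-- `p` is the continuous probability density of the value at time `1` of the spectrally positive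
`α`-stable Lévy process `L` with `E[exp (-l L_t)] = exp (t l ^ α)` for `l ≥ 0`
(the case `l = 0` says that the total mass is `1`). -/
structure IsStableDensity (α : ℝ) (p : ℝ → ℝ) : Prop where
  continuous : Continuous p
  nonneg : ∀ x, 0 ≤ p x
  laplace : ∀ l : ℝ, 0 ≤ l →
    ∫⁻ x, ENNReal.ofReal (Real.exp (-l * x) * p x) = ENNReal.ofReal (Real.exp (l ^ α))

/-- `σ` is an increasing Lévy process started at `0`, with
`E[exp (-l σ_t)] = exp (-t α l ^ (α - 1))` for `l ≥ 0`. -/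
structure IsStableSubordinator {Ω : Type*} [MeasurableSpace Ω] (α : ℝ) (σ : ℝ≥0 → Ω → ℝ)
    (P : Measure Ω) : Prop where
  measurable : ∀ t, Measurable (σ t)
  zero : ∀ᵐ ω ∂P, σ 0 ω = 0
  indep_increments : HasIndepIncrements σ P
  stationary : ∀ s t, P.map (fun ω => σ (s + t) ω - σ s ω) = P.map (σ t)
  monotone : ∀ᵐ ω ∂P, Monotone (fun t => σ t ω)
  cadlag : ∀ᵐ ω ∂P, IsCadlag (fun t => σ t ω)
  laplace : ∀ (t : ℝ≥0) (l : ℝ), 0 ≤ l →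
    ∫ ω, Real.exp (-l * σ t ω) ∂P = Real.exp (-(t * α * l ^ (α - 1)))

/-- The process `M_t = exp (∫_0^t σ_s ds) p(-σ_t) / p(0)`. -/
def changeDensity {Ω : Type*} (p : ℝ → ℝ) (σ : ℝ≥0 → Ω → ℝ) (t : ℝ≥0) (ω : Ω) : ℝ :=
  Real.exp (∫ s in Set.Iic t, σ s ω ∂lebesgue) * (p (-σ t ω) / p 0)

/-- `τ` is a càdlàg process whose law on each time interval `[0, t]` is the law of `σ` on `[0, t]`
under the probability measure with density `M_t`, that is,
`E[F((τ_s)_{s ≤ t})] = E[M_t F((σ_s)_{s ≤ t})]` for all bounded measurable `F`. -/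
structure IsMeasureChange {Ω Ω' : Type*} [MeasurableSpace Ω] [MeasurableSpace Ω'] (p : ℝ → ℝ)
    (σ : ℝ≥0 → Ω' → ℝ) (P' : Measure Ω') (τ : ℝ≥0 → Ω → ℝ) (P : Measure Ω) : Prop where
  measurable : ∀ t, Measurable (τ t)
  cadlag : ∀ᵐ ω ∂P, IsCadlag (fun t => τ t ω)
  law : ∀ t : ℝ≥0,
    P.map (fun ω (s : Set.Iic t) => τ s ω) =
      (P'.withDensity fun ω => ENNReal.ofReal (changeDensity p σ t ω)).map
        (fun ω (s : Set.Iic t) => σ s ω)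

end LineBreaking

end

/-! Write `X_k` for the left limit of the intensity at `Y_k`. The segment `(Y_k, Y_{k+1}]` is glued
at the first passage `Z_k` above `U_k X_k`. So `Z_k` lies in `[0, Y_0]`, or in an earlier segment
`(Y_j, Y_{j+1}]`, the parent, with `X_j ≤ τ_{Y_j} ≤ U_k X_k`. As `U` is independent of `(τ, Y)` and
has mean `1/2`, the value of `X` is at least halved in mean at each generation
(`lintegral_ancestorValue_le`). By Markov and Borel–Cantelli, for all but finitely many `k`, at most
`2 (log₂ (k + 1) + 1)` generations divide `X_k` by more than 4 or leave no ancestor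
(`ae_eventually_ancestorValue_lt`).

Sort the segments into levels `4 ^ n ≤ X_k < 4 ^ (n + 1)`. For large `n`, those of level `n` have
length at most `2 * 2 ^ (-n)` and indices at most exponential in `n`
(`ae_eventually_count_and_gap`), so a line of ancestors crosses level `n` in `O(n)` segments. Since
`∑ n 2 ^ (-n)` converges, every point is close to an initial part `[0, Y_K]`, which is totally
bounded; hence the completion is compact (`compactSpace_tree`).

The estimates on points require polynomial growth of the intensity (`exists_growth`), which follows
from tail bounds at fixed times. There `M_t ≤ exp (t σ_t) p (-σ_t) / p 0` because `σ` increases.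
Small values of `σ_t` are controlled by a Chernoff bound, and large ones by a bound on `exp (-l x) p
x` uniform in `x`, obtained by Fourier inversion of `exp (z ^ α)` on the line `Re z = l`
(`exists_exp_mul_le`). -/

namespace LineBreaking

/-! ### Bounds on exponentially tilted stable densities -/

section Density

open Filter Complex

/-- As `A → ∞` the angle tends to `α π / 2`, which lies strictly between `π / 2` and `π`. Outside
the cone of slope `A`, the real part of `z ^ α` is therefore negative. -/
theorem exists_cos_mul_arctan_neg {α : ℝ} (hα₁ : 1 < α) (hα₂ : α < 2) :
    ∃ A : ℝ, 1 ≤ A ∧ Real.cos (α * Real.arctan A) < 0 := by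
  have h1 : Tendsto Real.arctan atTop (nhds (Real.pi / 2)) :=
    Real.tendsto_arctan_atTop.mono_right nhdsWithin_le_nhds
  have h2 : ∀ᶠ A in atTop, Real.pi / 2 < α * Real.arctan A := by
    refine (h1.const_mul α).eventually (lt_mem_nhds ?_)
    nlinarith [Real.pi_pos]
  obtain ⟨A, hA, hA1⟩ := (h2.and (eventually_ge_atTop 1)).exists
  refine ⟨A, hA1, Real.cos_neg_of_pi_div_two_lt_of_lt hA ?_⟩
  have h3 := Real.arctan_lt_pi_div_two A
  nlinarith [Real.pi_pos]

theorem abs_arg_eq_arctan {z : ℂ} (hz : 0 < z.re) : |z.arg| = Real.arctan (|z.im| / z.re) := by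
  have h1 := Complex.abs_arg_lt_pi_div_two_iff.2 (Or.inl hz)
  have h2 : z.arg = Real.arctan (z.im / z.re) := by
    rw [← Complex.tan_arg, Real.arctan_tan (by linarith [neg_abs_le z.arg])
      (by linarith [le_abs_self z.arg])]
  rcases le_total 0 z.im with h | h
  · rw [h2, abs_of_nonneg h, abs_of_nonneg (by simpa using div_nonneg h hz.le)]
  · rw [h2, abs_of_nonpos h, neg_div, Real.arctan_neg, abs_of_nonpos]
    simpa using div_nonpos_of_nonpos_of_nonneg h hz.le

/-- On vertical lines, the real part of `z ^ α` tends to `-∞` at least linearly. -/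
theorem exists_re_cpow_le {α : ℝ} (hα₁ : 1 < α) (hα₂ : α < 2) :
    ∃ K c : ℝ, 0 < K ∧ 0 < c ∧ ∀ l : ℝ, 1 ≤ l → ∀ s : ℝ,
      (((l + s * I : ℂ) ^ (α : ℂ)).re ≤ K * l ^ 2 - c * |s|) := by
  obtain ⟨A, hA, hcos⟩ := exists_cos_mul_arctan_neg hα₁ hα₂
  set c := -Real.cos (α * Real.arctan A) with hc
  have hc0 : 0 < c := by linarith
  -- Inside the cone `|s| ≤ A l`, the term `(1 + A) ^ 2` bounds `‖z‖ ^ α` and `c A` pays for `c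
  -- |s|`. Outside it, the cosine is at most `-c` and `‖z‖ ^ α ≥ |s|`.
  refine ⟨(1 + A) ^ 2 + c * A, c, by positivity, hc0, fun l hl s => ?_⟩
  set z : ℂ := l + s * I with hz
  have hre : z.re = l := by simp [hz]
  have him : z.im = s := by simp [hz]
  rw [Complex.cpow_ofReal_re]
  rcases le_total |s| (A * l) with h | h
  · have h1 : ‖z‖ ≤ (1 + A) * l := by
      refine (Complex.norm_le_abs_re_add_abs_im z).trans ?_
      rw [hre, him, abs_of_pos (by linarith)]
      linarith
    have h2 : ‖z‖ ^ α ≤ ((1 + A) * l) ^ 2 := by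
      refine (Real.rpow_le_rpow (norm_nonneg _) h1 (by linarith)).trans ?_
      rw [← Real.rpow_natCast]
      exact Real.rpow_le_rpow_of_exponent_le (by nlinarith) (by exact_mod_cast hα₂.le)
    have h3 : ‖z‖ ^ α * Real.cos (z.arg * α) ≤ ‖z‖ ^ α :=
      mul_le_of_le_one_right (by positivity) (Real.cos_le_one _)
    have h4 : c * |s| ≤ c * A * l ^ 2 := by
      rw [mul_assoc]
      refine mul_le_mul_of_nonneg_left (h.trans ?_) hc0.le
      exact mul_le_mul_of_nonneg_left (le_self_pow₀ hl two_ne_zero) (by linarith)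
    nlinarith
  · have hs : 1 ≤ |s| := by nlinarith
    have h1 : Real.cos (z.arg * α) ≤ -c := by
      rw [← Real.cos_abs, abs_mul, abs_arg_eq_arctan (by rw [hre]; linarith), hre, him,
        abs_of_pos (show 0 < α by linarith), mul_comm, hc, neg_neg]
      have h5 := Real.arctan_lt_pi_div_two (|s| / l)
      refine Real.cos_le_cos_of_nonneg_of_le_pi ?_ ?_ ?_
      · have : 0 ≤ Real.arctan A := by simpa using (zero_le_one.trans hA)
        positivity
      · nlinarith [Real.pi_pos]
      · refine mul_le_mul_of_nonneg_left (Real.arctan_mono ?_) (by linarith)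
        rwa [le_div_iff₀ (by linarith)]
    have h2 : |s| ≤ ‖z‖ ^ α := by
      have h3 : |s| ≤ ‖z‖ := by rw [← him]; exact Complex.abs_im_le_norm z
      refine h3.trans ?_
      conv_lhs => rw [← Real.rpow_one ‖z‖]
      exact Real.rpow_le_rpow_of_exponent_le (hs.trans h3) hα₁.le
    have h4 : ‖z‖ ^ α * Real.cos (z.arg * α) ≤ ‖z‖ ^ α * -c :=
      mul_le_mul_of_nonneg_left h1 (by positivity)
    have h5 : 0 ≤ ((1 + A) ^ 2 + c * A) * l ^ 2 := by positivity
    nlinarith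

variable {α : ℝ} {p : ℝ → ℝ}

theorem IsStableDensity.integrable_exp_mul (hp : IsStableDensity α p) {l : ℝ} (hl : 0 ≤ l) :
    Integrable (fun x => Real.exp (-l * x) * p x) := by
  have hc := hp.continuous
  refine ⟨(by fun_prop : Continuous _).aestronglyMeasurable, ?_⟩
  rw [hasFiniteIntegral_iff_ofReal
    (Eventually.of_forall fun x => mul_nonneg (Real.exp_pos _).le (hp.nonneg x)), hp.laplace l hl]
  exact ENNReal.ofReal_lt_top

theorem IsStableDensity.integral_exp_mul (hp : IsStableDensity α p) {l : ℝ} (hl : 0 ≤ l) :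
    ∫ x, Real.exp (-l * x) * p x = Real.exp (l ^ α) := by
  rw [integral_eq_lintegral_of_nonneg_ae
    (Eventually.of_forall fun x => mul_nonneg (Real.exp_pos _).le (hp.nonneg x))
    (hp.integrable_exp_mul hl).1, hp.laplace l hl, ENNReal.toReal_ofReal (Real.exp_pos _).le]

/-- The Laplace transform of the stable density on the right half-plane. -/
theorem IsStableDensity.integral_cexp_mul (hp : IsStableDensity α p) {z : ℂ} (hz : 0 < z.re) :
    ∫ x : ℝ, cexp (-z * x) * p x = cexp (z ^ (α : ℂ)) := by
  set ν : Measure ℝ := volume.withDensity fun x => ENNReal.ofReal (p x) with hν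
  have hpm : Measurable fun x => (p x).toNNReal := hp.continuous.measurable.real_toNNReal
  have hint : ∀ w : ℂ, complexMGF (fun x => -x) ν w = ∫ x : ℝ, cexp (-w * x) * p x := by
    intro w
    rw [complexMGF, hν]
    simp only [ENNReal.ofReal]
    rw [integral_withDensity_eq_integral_smul hpm]
    congr 1 with x
    rw [NNReal.smul_def, Real.coe_toNNReal _ (hp.nonneg x)]
    simp [mul_comm]
  have hset : Set.Ici 0 ⊆ integrableExpSet (fun x : ℝ => -x) ν := by
    intro l hl
    rw [integrableExpSet, Set.mem_ofPred_eq, hν]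
    simp only [ENNReal.ofReal]
    rw [integrable_withDensity_iff_integrable_smul hpm]
    refine (hp.integrable_exp_mul hl).congr (Eventually.of_forall fun x => ?_)
    simp only [NNReal.smul_def, Real.coe_toNNReal _ (hp.nonneg x), smul_eq_mul]
    rw [mul_comm]; simp
  have hsub : {w : ℂ | 0 < w.re} ⊆
      {w | w.re ∈ interior (integrableExpSet (fun x : ℝ => -x) ν)} := by
    intro w hw
    have := interior_mono hset
    rw [interior_Ici] at this
    exact this hw
  have han1 : AnalyticOnNhd ℂ (complexMGF (fun x : ℝ => -x) ν) {w | 0 < w.re} :=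
    analyticOnNhd_complexMGF.mono hsub
  have hopen : IsOpen {w : ℂ | 0 < w.re} := isOpen_lt continuous_const Complex.continuous_re
  have han2 : AnalyticOnNhd ℂ (fun w : ℂ => cexp (w ^ (α : ℂ))) {w | 0 < w.re} := by
    refine DifferentiableOn.analyticOnNhd (fun w hw => ?_) hopen
    exact ((differentiableAt_id.cpow_const (Or.inl hw)).cexp).differentiableWithinAt
  have hconv : IsPreconnected {w : ℂ | 0 < w.re} := (convex_halfSpace_re_gt 0).isPreconnected
  -- Identity theorem: both sides are analytic on the half-plane and agree at the real points `1 + 1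
  -- / (n + 1)`, which accumulate at `1`.
  have heq := han1.eqOn_of_preconnected_of_frequently_eq han2 hconv (z₀ := 1) (by simp) ?_
  · rw [← hint]; exact heq hz
  · have hreal : ∀ l : ℝ, 0 ≤ l → complexMGF (fun x : ℝ => -x) ν l = cexp ((l : ℂ) ^ (α : ℂ)) := by
      intro l hl
      rw [hint, ← Complex.ofReal_cpow hl, ← Complex.ofReal_exp, ← hp.integral_exp_mul hl,
        ← integral_complex_ofReal]
      congr 1 with x
      push_cast
      rfl
    have ht : Tendsto (fun n : ℕ => ((1 + 1 / ((n : ℝ) + 1) : ℝ) : ℂ)) atTop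
        (nhdsWithin 1 {1}ᶜ) := by
      refine tendsto_nhdsWithin_iff.2 ⟨?_, Eventually.of_forall fun n => ?_⟩
      · have := (tendsto_one_div_add_atTop_nhds_zero_nat (𝕜 := ℝ)).const_add 1
        rw [add_zero] at this
        exact_mod_cast (Complex.continuous_ofReal.tendsto _).comp this
      · have : (0 : ℝ) < 1 / ((n : ℝ) + 1) := by positivity
        have h1 : (1 + 1 / ((n : ℝ) + 1)) ≠ 1 := ne_of_gt (lt_add_of_pos_right 1 this)
        exact fun h => h1 (Complex.ofReal_injective (h.trans Complex.ofReal_one.symm))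
    refine ht.frequently (Frequently.of_forall fun n => hreal _ (by positivity))

theorem integrable_exp_neg_mul_abs {c : ℝ} (hc : 0 < c) :
    Integrable fun s : ℝ => Real.exp (-(c * |s|)) := by
  have h1 : IntegrableOn (fun s : ℝ => Real.exp (-(c * |s|))) (Set.Ioi 0) :=
    (integrableOn_exp_mul_Ioi (neg_neg_of_pos hc) 0).congr_fun
      (fun s hs => by simp [abs_of_pos (show 0 < s from hs)]) measurableSet_Ioi
  have h2 : IntegrableOn (fun s : ℝ => Real.exp (-(c * |s|))) (Set.Iic 0) :=
    (integrableOn_exp_mul_Iic hc 0).congr_fun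
      (fun s hs => by simp [abs_of_nonpos (show s ≤ 0 from hs)]) measurableSet_Iic
  rw [← integrableOn_univ, ← Set.Iic_union_Ioi (a := (0 : ℝ))]
  exact h2.union h1

/-- Exponentially tilted versions of the stable density are bounded. -/
theorem IsStableDensity.exists_exp_mul_le (hα₁ : 1 < α) (hα₂ : α < 2) (hp : IsStableDensity α p) :
    ∃ K D : ℝ, 0 < K ∧ 0 < D ∧ ∀ l : ℝ, 1 ≤ l → ∀ x : ℝ,
      Real.exp (-l * x) * p x ≤ D * Real.exp (K * l ^ 2) := by
  obtain ⟨K, c, hK, hc, hle⟩ := exists_re_cpow_le hα₁ hα₂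
  set g : ℝ → ℝ := fun s => Real.exp (-((c * (2 * Real.pi)) * |s|)) with hg
  have hgi : Integrable g := integrable_exp_neg_mul_abs (by positivity)
  refine ⟨K, ∫ s, g s, hK, integral_exp_pos hgi, fun l hl x => ?_⟩
  have hl0 : 0 ≤ l := by linarith
  set f : ℝ → ℂ := fun x => ((Real.exp (-l * x) * p x : ℝ) : ℂ) with hf
  have hfc : Continuous f := by have := hp.continuous; fun_prop
  have hfi : Integrable f := (hp.integrable_exp_mul hl0).ofReal
  -- The Fourier transform of the tilted density is its Laplace transform on the line `Re z = l`;
  -- the factor `2 π` in `g` comes from the normalization of the Fourier transform.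
  have hF : ∀ s : ℝ, FourierTransform.fourier f s =
      cexp ((l + (2 * Real.pi * s : ℝ) * I : ℂ) ^ (α : ℂ)) := by
    intro s
    rw [Real.fourier_real_eq_integral_exp_smul, ← hp.integral_cexp_mul (by simp; linarith)]
    congr 1 with v
    simp only [hf, smul_eq_mul]
    push_cast
    rw [← mul_assoc, ← Complex.exp_add]
    congr 2
    ring
  have hFn : ∀ s : ℝ, ‖FourierTransform.fourier f s‖ ≤ Real.exp (K * l ^ 2) * g s := by
    intro s
    rw [hF, Complex.norm_exp, hg, ← Real.exp_add]
    refine Real.exp_le_exp.2 ((hle l hl _).trans (le_of_eq ?_))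
    rw [abs_mul, abs_of_pos (show 0 < 2 * Real.pi by positivity)]
    ring
  have hFm : AEStronglyMeasurable (FourierTransform.fourier f) volume :=
    (VectorFourier.fourierIntegral_continuous Real.continuous_fourierChar
      (by exact continuous_inner) hfi).aestronglyMeasurable
  have hFi : Integrable (FourierTransform.fourier f) :=
    (hgi.const_mul (Real.exp (K * l ^ 2))).mono' hFm (Eventually.of_forall hFn)
  have hinv := congrFun (hfc.fourierInv_fourier_eq hfi hFi) x
  have h1 : ‖f x‖ ≤ ∫ s, ‖FourierTransform.fourier f s‖ := by
    rw [← hinv, Real.fourierInv_eq']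
    refine (norm_integral_le_integral_norm _).trans (le_of_eq ?_)
    congr 1 with s
    rw [norm_smul, Complex.norm_exp]
    simp
  have h2 : ‖f x‖ = Real.exp (-l * x) * p x := by
    rw [hf, Complex.norm_real, Real.norm_of_nonneg (mul_nonneg (Real.exp_pos _).le (hp.nonneg x))]
  rw [← h2]
  refine h1.trans ((integral_mono hFi.norm (hgi.const_mul _) hFn).trans (le_of_eq ?_))
  rw [integral_const_mul, mul_comm]

end Density

/-! ### Decay of the intensity along lines of ancestors -/

section Ancestors

open Filter Finset

/-- The index `j` is the last one before `k` with `r j ≤ v * x k`. -/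
def IsParent (v : ℝ≥0∞) (x r : ℕ → ℝ≥0∞) (j k : ℕ) : Prop :=
  j < k ∧ r j ≤ v * x k ∧ ∀ i, j < i → i < k → v * x k < r i

/-- The value of `x` at the `m`-th ancestor of `k`, and `0` if there is none. -/
noncomputable def ancestorValue (u x r : ℕ → ℝ≥0∞) : ℕ → ℕ → ℝ≥0∞
  | 0, k => x k
  | m + 1, k => ∑ j ∈ range k,
      {v | IsParent v x r j k}.indicator 1 (u k) * ancestorValue u x r m j

theorem IsParent.unique {v : ℝ≥0∞} {x r : ℕ → ℝ≥0∞} {i j k : ℕ} (hi : IsParent v x r i k)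
    (hj : IsParent v x r j k) : i = j := by
  rcases lt_trichotomy i j with h | h | h
  · exact absurd hj.2.1 (not_le.2 (hi.2.2 j h hj.1))
  · exact h
  · exact absurd hi.2.1 (not_le.2 (hj.2.2 i h hi.1))

theorem exists_isParent_or (v : ℝ≥0∞) (x r : ℕ → ℝ≥0∞) (k : ℕ) :
    (∃ j, IsParent v x r j k) ∨ ∀ j < k, v * x k < r j := by
  by_cases h : ∃ j < k, r j ≤ v * x k
  · left
    obtain ⟨j, hj, hr⟩ := h
    classical
    set s := (range k).filter fun i => r i ≤ v * x k with hs
    have hne : s.Nonempty := ⟨j, by simp [hs, hj, hr]⟩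
    have hm := s.max'_mem hne
    simp only [hs, mem_filter, mem_range] at hm
    refine ⟨s.max' hne, hm.1, hm.2, fun i hi hik => not_le.1 fun hle => ?_⟩
    exact absurd (s.le_max' i (by simp [hs, hik, hle])) (not_le.2 hi)
  · right
    push Not at h
    exact h

theorem sum_indicator_isParent {v : ℝ≥0∞} {x r : ℕ → ℝ≥0∞} {j k : ℕ} (h : IsParent v x r j k)
    (f : ℕ → ℝ≥0∞) :
    ∑ i ∈ range k, {v | IsParent v x r i k}.indicator 1 v * f i = f j := by
  rw [sum_eq_single j]
  · rw [Set.indicator_of_mem (by exact h)]; simp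
  · intro i _ hij
    rw [Set.indicator_of_notMem (s := {v | IsParent v x r i k})
      (fun hi => hij (IsParent.unique hi h)), zero_mul]
  · exact fun hj => absurd (mem_range.2 h.1) hj

theorem sum_indicator_isParent_le {v c : ℝ≥0∞} {x r : ℕ → ℝ≥0∞} {k : ℕ} {f : ℕ → ℝ≥0∞}
    (h : ∀ j, IsParent v x r j k → f j ≤ c) :
    ∑ i ∈ range k, {v | IsParent v x r i k}.indicator 1 v * f i ≤ c := by
  by_cases hp : ∃ j, IsParent v x r j k
  · obtain ⟨j, hj⟩ := hp
    rw [sum_indicator_isParent hj]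
    exact h j hj
  · push Not at hp
    rw [sum_eq_zero fun i _ => ?_]
    · exact zero_le
    · rw [Set.indicator_of_notMem (s := {v | IsParent v x r i k}) (hp i), zero_mul]

theorem ancestorValue_succ_of_isParent {u x r : ℕ → ℝ≥0∞} {j k : ℕ}
    (h : IsParent (u k) x r j k) (m : ℕ) :
    ancestorValue u x r (m + 1) k = ancestorValue u x r m j := by
  rw [ancestorValue, sum_indicator_isParent h]

theorem ancestorValue_congr {u u' x r : ℕ → ℝ≥0∞} (m : ℕ) :
    ∀ k, (∀ i ≤ k, u i = u' i) → ancestorValue u x r m k = ancestorValue u' x r m k := by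
  induction m with
  | zero => exact fun _ _ => rfl
  | succ m ih =>
    intro k hk
    simp only [ancestorValue]
    refine sum_congr rfl fun j hj => ?_
    rw [hk k le_rfl, ih j fun i hi => hk i (hi.trans (mem_range.1 hj).le)]

theorem measurableSet_isParent (j k : ℕ) :
    MeasurableSet {q : ℝ≥0∞ × (ℕ → ℝ≥0∞) × (ℕ → ℝ≥0∞) | IsParent q.1 q.2.1 q.2.2 j k} := by
  have h : {q : ℝ≥0∞ × (ℕ → ℝ≥0∞) × (ℕ → ℝ≥0∞) | IsParent q.1 q.2.1 q.2.2 j k} =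
      {q | j < k} ∩ ({q | q.2.2 j ≤ q.1 * q.2.1 k} ∩
        ⋂ i, {q | j < i → i < k → q.1 * q.2.1 k < q.2.2 i}) := by
    ext q; simp [IsParent]
  rw [h]
  refine (MeasurableSet.const _).inter ((measurableSet_le (by fun_prop) (by fun_prop)).inter
    (MeasurableSet.iInter fun i => ?_))
  by_cases hi : j < i ∧ i < k
  · simp only [hi.1, hi.2, forall_const]
    exact measurableSet_lt (by fun_prop) (by fun_prop)
  · have : {q : ℝ≥0∞ × (ℕ → ℝ≥0∞) × (ℕ → ℝ≥0∞) | j < i → i < k → q.1 * q.2.1 k < q.2.2 i} =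
        Set.univ := Set.eq_univ_of_forall fun q h1 h2 => absurd ⟨h1, h2⟩ hi
    rw [this]
    exact MeasurableSet.univ

theorem measurable_ancestorValue (m k : ℕ) :
    Measurable fun q : (ℕ → ℝ≥0∞) × (ℕ → ℝ≥0∞) × (ℕ → ℝ≥0∞) =>
      ancestorValue q.1 q.2.1 q.2.2 m k := by
  induction m generalizing k with
  | zero => simp only [ancestorValue]; fun_prop
  | succ m ih =>
    simp only [ancestorValue]
    refine Finset.measurable_sum _ fun j _ => Measurable.mul ?_ (ih j)
    have h : Measurable fun q : (ℕ → ℝ≥0∞) × (ℕ → ℝ≥0∞) × (ℕ → ℝ≥0∞) => (q.1 k, q.2) := by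
      fun_prop
    exact ((measurable_one (α := ℝ≥0∞)).indicator (measurableSet_isParent j k)).comp h

variable {Ω : Type*} [MeasurableSpace Ω] {P : Measure Ω} [IsProbabilityMeasure P]

/-- A parent `j` of `k` has `x j ≤ r j ≤ V k * x k`, and the right side has mean at most `x k / 2`.
The choice of the parent depends on `V k` only and the further ancestors of `j` on the `V i` with `i
≤ j < k`, so the expectations factor and each generation contributes `1/2`. -/
theorem lintegral_ancestorValue_le {V : ℕ → Ω → ℝ≥0∞} (hV : ∀ k, Measurable (V k))
    (hind : iIndepFun V P) (hmean : ∀ k, ∫⁻ ω, V k ω ∂P ≤ 2⁻¹) {x r : ℕ → ℝ≥0∞} (hxr : x ≤ r)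
    (m k : ℕ) :
    ∫⁻ ω, ancestorValue (fun i => V i ω) x r m k ∂P ≤ 2⁻¹ ^ m * x k := by
  induction m generalizing k with
  | zero => simp [ancestorValue]
  | succ m ih =>
    have hmeas : ∀ j, Measurable fun u : ℕ → ℝ≥0∞ => ancestorValue u x r m j := fun j =>
      (measurable_ancestorValue m j).comp (measurable_id.prodMk (measurable_const (a := (x, r))))
    have hVm : Measurable fun ω i => V i ω := measurable_pi_lambda _ hV
    have hset : ∀ j, MeasurableSet {v | IsParent v x r j k} := fun j =>
      (measurableSet_isParent j k).preimage (measurable_id.prodMk (measurable_const (a := (x, r))))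
    have hI : ∀ j, Measurable ({v | IsParent v x r j k}.indicator (1 : ℝ≥0∞ → ℝ≥0∞)) :=
      fun j => measurable_one.indicator (hset j)
    have hindep : ∀ j ∈ range k, ∫⁻ ω, {v | IsParent v x r j k}.indicator 1 (V k ω) *
        ancestorValue (fun i => V i ω) x r m j ∂P =
        (∫⁻ ω, {v | IsParent v x r j k}.indicator 1 (V k ω) ∂P) *
          ∫⁻ ω, ancestorValue (fun i => V i ω) x r m j ∂P := by
      intro j hj
      have h1 := hind.indepFun_finset {k} (range k) (by simp) hV
      -- Padding by `0` exhibits the ancestor value of `j` as a function of the `V i` with `i < k`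
      -- alone.
      set ext : (range k → ℝ≥0∞) → ℕ → ℝ≥0∞ := fun w i => if h : i ∈ range k then w ⟨i, h⟩ else 0
        with hext
      have hextm : Measurable ext := by
        refine measurable_pi_lambda _ fun i => ?_
        by_cases h : i ∈ range k
        · simp only [hext, h, dif_pos]; fun_prop
        · simp only [hext, h, dif_neg, not_false_iff]; fun_prop
      have hφ : Measurable fun w : ({k} : Finset ℕ) → ℝ≥0∞ =>
          {v | IsParent v x r j k}.indicator (1 : ℝ≥0∞ → ℝ≥0∞) (w ⟨k, mem_singleton_self k⟩) :=
        (hI j).comp (measurable_pi_apply _)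
      have h2 := h1.comp hφ ((hmeas j).comp hextm)
      have h3 : ∀ ω, ancestorValue (fun i => V i ω) x r m j =
          ancestorValue (ext fun i => V i ω) x r m j := by
        intro ω
        refine ancestorValue_congr m j fun i hi => ?_
        have : i ∈ range k := mem_range.2 (hi.trans_lt (mem_range.1 hj))
        simp only [hext, this, dif_pos]
      simp only [h3]
      refine lintegral_mul_eq_lintegral_mul_lintegral_of_indepFun ((hI j).comp (hV k))
        ((hmeas j).comp (hextm.comp (measurable_pi_lambda _ fun i => hV i))) h2
    calc ∫⁻ ω, ancestorValue (fun i => V i ω) x r (m + 1) k ∂P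
        = ∑ j ∈ range k, ∫⁻ ω, {v | IsParent v x r j k}.indicator 1 (V k ω) *
            ancestorValue (fun i => V i ω) x r m j ∂P := by
          simp only [ancestorValue]
          exact lintegral_finsetSum _ fun j _ =>
            ((hI j).comp (hV k)).mul ((hmeas j).comp hVm)
      _ ≤ ∑ j ∈ range k, (∫⁻ ω, {v | IsParent v x r j k}.indicator 1 (V k ω) ∂P) *
            (2⁻¹ ^ m * x j) := by
          refine sum_le_sum fun j hj => ?_
          rw [hindep j hj]
          gcongr
          exact ih j
      _ = 2⁻¹ ^ m * ∫⁻ ω, ∑ j ∈ range k,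
            {v | IsParent v x r j k}.indicator 1 (V k ω) * x j ∂P := by
          rw [lintegral_finsetSum (range k) (f := fun j ω =>
            {v | IsParent v x r j k}.indicator 1 (V k ω) * x j)
            fun j _ => ((hI j).comp (hV k)).mul_const _, mul_sum]
          refine sum_congr rfl fun j _ => ?_
          have h5 := lintegral_mul_const (μ := P) (x j) ((hI j).comp (hV k))
          simp only [Function.comp_apply] at h5
          rw [h5]
          ring
      _ ≤ 2⁻¹ ^ m * ∫⁻ ω, V k ω * x k ∂P := by
          gcongr with ω
          exact sum_indicator_isParent_le fun j hj => (hxr j).trans hj.2.1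
      _ ≤ 2⁻¹ ^ m * (2⁻¹ * x k) := by
          rw [lintegral_mul_const _ (hV k)]
          gcongr
          exact hmean k
      _ = 2⁻¹ ^ (m + 1) * x k := by ring

/-- Fubini for the product law: the independent variable `g` may be frozen, so estimates for
deterministic `x` and `r` transfer to random ones. -/
theorem measure_le_of_indepFun {E F : Type*} [MeasurableSpace E] [MeasurableSpace F]
    {f : Ω → E} {g : Ω → F} (hf : Measurable f) (hg : Measurable g) (hfg : IndepFun f g P)
    {S : Set (E × F)} (hS : MeasurableSet S) {c : ℝ≥0∞}
    (h : ∀ b, P {ω | (f ω, b) ∈ S} ≤ c) : P {ω | (f ω, g ω) ∈ S} ≤ c := by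
  have h1 : P {ω | (f ω, g ω) ∈ S} = P.map (fun ω => (f ω, g ω)) S :=
    (Measure.map_apply (hf.prodMk hg) hS).symm
  have : IsProbabilityMeasure (P.map f) := Measure.isProbabilityMeasure_map hf.aemeasurable
  have : IsProbabilityMeasure (P.map g) := Measure.isProbabilityMeasure_map hg.aemeasurable
  rw [h1, (indepFun_iff_map_prod_eq_prod_map_map hf.aemeasurable hg.aemeasurable).1 hfg,
    Measure.prod_apply_symm hS]
  calc ∫⁻ b, P.map f ((fun a => (a, b)) ⁻¹' S) ∂(P.map g) ≤ ∫⁻ _, c ∂(P.map g) := by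
        refine lintegral_mono fun b => ?_
        rw [Measure.map_apply hf (hS.preimage (by fun_prop))]
        exact h b
    _ = c := by simp

/-- Almost surely, for all but finitely many indices `k`, the value of `x` at the `m k`-th ancestor
of `k` is at most a quarter of its value at `k`. -/
theorem ae_eventually_ancestorValue_lt {V : ℕ → Ω → ℝ≥0∞} (hV : ∀ k, Measurable (V k))
    (hind : iIndepFun V P) (hmean : ∀ k, ∫⁻ ω, V k ω ∂P ≤ 2⁻¹) {x r : Ω → ℕ → ℝ≥0∞}
    (hx : Measurable x) (hr : Measurable r)
    (hVx : IndepFun (fun ω k => V k ω) (fun ω => (x ω, r ω)) P)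
    (hxr : ∀ᵐ ω ∂P, x ω ≤ r ω) (hpos : ∀ᵐ ω ∂P, ∀ k, 0 < x ω k ∧ x ω k < ∞)
    {m : ℕ → ℕ} (hm : ∑' k, (2⁻¹ : ℝ≥0∞) ^ m k ≠ ∞) :
    ∀ᵐ ω ∂P, ∀ᶠ k in atTop,
      ancestorValue (fun i => V i ω) (x ω) (r ω) (m k) k < x ω k / 4 := by
  -- The almost sure constraints on `x` and `r` are built into the event, so that a frozen pair
  -- violating them gives the empty set.
  set S : ℕ → Set ((ℕ → ℝ≥0∞) × (ℕ → ℝ≥0∞) × (ℕ → ℝ≥0∞)) := fun k =>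
    {q | q.2.1 ≤ q.2.2 ∧ (0 < q.2.1 k ∧ q.2.1 k < ∞) ∧
      q.2.1 k / 4 ≤ ancestorValue q.1 q.2.1 q.2.2 (m k) k} with hSdef
  have hS : ∀ k, MeasurableSet (S k) := by
    intro k
    have h1 : Measurable fun q : (ℕ → ℝ≥0∞) × (ℕ → ℝ≥0∞) × (ℕ → ℝ≥0∞) => q.2.1 k := by fun_prop
    have h2 : Measurable fun q : (ℕ → ℝ≥0∞) × (ℕ → ℝ≥0∞) × (ℕ → ℝ≥0∞) => q.2.1 := by fun_prop
    have h3 : Measurable fun q : (ℕ → ℝ≥0∞) × (ℕ → ℝ≥0∞) × (ℕ → ℝ≥0∞) => q.2.2 := by fun_prop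
    exact (measurableSet_le h2 h3).inter (((measurableSet_lt measurable_const h1).inter
      (measurableSet_lt h1 measurable_const)).inter
        (measurableSet_le (h1.div_const 4) (measurable_ancestorValue _ _)))
  have hVm : Measurable fun ω i => V i ω := measurable_pi_lambda _ hV
  -- Markov's inequality: a mean of at most `2⁻¹ ^ m k * x k` against the threshold `x k / 4`.
  have hle : ∀ k, P {ω | ((fun i => V i ω), (x ω, r ω)) ∈ S k} ≤ 4 * 2⁻¹ ^ m k := by
    intro k
    refine measure_le_of_indepFun hVm (hx.prodMk hr) hVx (hS k) fun b => ?_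
    by_cases hb : b.1 ≤ b.2 ∧ (0 < b.1 k ∧ b.1 k < ∞)
    · have hmeas : Measurable fun ω => ancestorValue (fun i => V i ω) b.1 b.2 (m k) k :=
        (measurable_ancestorValue (m k) k).comp (hVm.prodMk measurable_const)
      have h4 : b.1 k / 4 ≠ 0 := (ENNReal.div_pos hb.2.1.ne' (by norm_num)).ne'
      have h4' : b.1 k / 4 ≠ ∞ := ENNReal.div_ne_top hb.2.2.ne (by norm_num)
      refine (measure_mono fun ω hω => hω.2.2).trans
        ((meas_ge_le_lintegral_div hmeas.aemeasurable h4 h4').trans ?_)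
      refine ENNReal.div_le_of_le_mul
        ((lintegral_ancestorValue_le hV hind hmean hb.1 _ _).trans (le_of_eq ?_))
      rw [mul_comm 4, mul_assoc, ENNReal.mul_div_cancel (by norm_num) (by norm_num)]
    · have : {ω | ((fun i => V i ω), b) ∈ S k} = ∅ :=
        Set.eq_empty_of_forall_notMem fun ω hω => hb ⟨hω.1, hω.2.1⟩
      rw [this, measure_empty]
      exact zero_le
  have hsum : ∑' k, P {ω | ((fun i => V i ω), (x ω, r ω)) ∈ S k} ≠ ∞ := by
    refine ne_top_of_le_ne_top ?_ (ENNReal.tsum_le_tsum hle)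
    rw [ENNReal.tsum_mul_left]
    exact ENNReal.mul_ne_top (by norm_num) hm
  filter_upwards [ae_eventually_notMem hsum, hxr, hpos] with ω h1 h2 h3
  filter_upwards [h1] with k hk
  exact not_le.1 fun h => hk ⟨h2, h3 k, h⟩

/-- Almost surely, `V i * x i` avoids the values of `r`. -/
theorem ae_mul_ne_of_indepFun {V : ℕ → Ω → ℝ≥0∞} (hV : ∀ k, Measurable (V k))
    (hVa : ∀ k c, P {ω | V k ω = c} = 0) {x r : Ω → ℕ → ℝ≥0∞}
    (hx : Measurable x) (hr : Measurable r)
    (hVx : IndepFun (fun ω k => V k ω) (fun ω => (x ω, r ω)) P)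
    (hpos : ∀ᵐ ω ∂P, ∀ k, 0 < x ω k ∧ x ω k < ∞) :
    ∀ᵐ ω ∂P, ∀ j k, V k ω * x ω k ≠ r ω j := by
  rw [ae_all_iff]; intro j
  rw [ae_all_iff]; intro k
  set S : Set ((ℕ → ℝ≥0∞) × (ℕ → ℝ≥0∞) × (ℕ → ℝ≥0∞)) :=
    {q | (0 < q.2.1 k ∧ q.2.1 k < ∞) ∧ q.1 k * q.2.1 k = q.2.2 j} with hSdef
  have hS : MeasurableSet S := by
    have h1 : Measurable fun q : (ℕ → ℝ≥0∞) × (ℕ → ℝ≥0∞) × (ℕ → ℝ≥0∞) => q.2.1 k := by fun_prop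
    have h2 : Measurable fun q : (ℕ → ℝ≥0∞) × (ℕ → ℝ≥0∞) × (ℕ → ℝ≥0∞) => q.1 k := by fun_prop
    have h3 : Measurable fun q : (ℕ → ℝ≥0∞) × (ℕ → ℝ≥0∞) × (ℕ → ℝ≥0∞) => q.2.2 j := by fun_prop
    exact ((measurableSet_lt measurable_const h1).inter (measurableSet_lt h1 measurable_const)).inter
      (measurableSet_eq_fun (h2.mul h1) h3)
  have h0 : P {ω | ((fun i => V i ω), (x ω, r ω)) ∈ S} ≤ 0 := by
    refine measure_le_of_indepFun (measurable_pi_lambda _ hV) (hx.prodMk hr) hVx hS fun b => ?_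
    by_cases hb : 0 < b.1 k ∧ b.1 k < ∞
    · refine (measure_mono fun ω hω => ?_).trans (hVa k (b.2 j / b.1 k)).le
      exact (ENNReal.eq_div_iff hb.1.ne' hb.2.ne).2 (by rw [mul_comm]; exact hω.2)
    · have : {ω | ((fun i => V i ω), b) ∈ S} = ∅ :=
        Set.eq_empty_of_forall_notMem fun ω hω => hb hω.1
      rw [this, measure_empty]
  have h1 : ∀ᵐ ω ∂P, ((fun i => V i ω), (x ω, r ω)) ∉ S := by
    rw [ae_iff]; simpa using h0
  filter_upwards [h1, hpos] with ω h2 h3 h4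
  exact h2 ⟨h3 k, h4⟩

end Ancestors

/-! ### A deterministic criterion for compactness -/

section Compactness

open Filter

variable {y z : ℕ → ℝ≥0}

theorem lineDist_self (u : ℝ≥0) : lineDist y z u u = 0 := gluedDist_self _ _

theorem lineDist_of_le_of_lt (h : IsCutAttach y z) {k : ℕ} {u v : ℝ≥0} (hu : u ≤ y k)
    (hv : y k < v) (hv' : v ≤ y (k + 1)) :
    lineDist y z u v = lineDist y z u (z k) + ((v : ℝ) - y k) := by
  have hk : y k ≤ y (k + 1) := (h.strictMono (Nat.lt_succ_self k)).le
  rw [lineDist_eq h (k := k + 2) (hu.trans hk) hv', lineDist_eq h (k := k + 1) hu (h.lt k).le,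
    gluedDist]
  have h1 : u ≤ consZero y (k + 1) := hu
  have h2 : ¬v ≤ consZero y (k + 1) := not_le.2 hv
  have h3 : (0 : ℝ) ≤ (v : ℝ) - y k := sub_nonneg.2 (by exact_mod_cast hv.le)
  rw [if_pos h1, if_neg h2]
  simp only [consZero]
  rw [abs_of_nonneg h3]

theorem lineDist_of_lt_of_lt (h : IsCutAttach y z) {k : ℕ} {u v : ℝ≥0} (hu : y k < u)
    (hu' : u ≤ y (k + 1)) (hv : y k < v) (hv' : v ≤ y (k + 1)) :
    lineDist y z u v = |(v : ℝ) - u| := by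
  rw [lineDist_eq h (k := k + 2) hu' hv', gluedDist]
  have h1 : ¬u ≤ consZero y (k + 1) := not_le.2 hu
  have h2 : ¬v ≤ consZero y (k + 1) := not_le.2 hv
  rw [if_neg h1, if_neg h2]

theorem lineDist_le_of_le_zero (h : IsCutAttach y z) {u v : ℝ≥0} (hu : u ≤ y 0)
    (hv : v ≤ y 0) : lineDist y z u v ≤ |(v : ℝ) - u| := by
  rw [lineDist_eq h (k := 1) hu hv]
  rcases eq_or_ne u 0 with rfl | hu0 <;> rcases eq_or_ne v 0 with rfl | hv0 <;>
    simp [gluedDist, consZero, *]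

/-- The identity map of the half-line, with values in the half-line with the line-breaking
metric. -/
def toPreTree (h : IsCutAttach y z) (u : ℝ≥0) : PreTree h := u

theorem dist_toPreTree (h : IsCutAttach y z) (u v : ℝ≥0) :
    dist (toPreTree h u) (toPreTree h v) = lineDist y z u v := rfl

theorem toPreTree_surjective (h : IsCutAttach y z) : Function.Surjective (toPreTree h) :=
  fun v => ⟨v, rfl⟩

theorem totallyBounded_of_lineDist_le (h : IsCutAttach y z) {S : Set ℝ≥0} (hS : TotallyBounded S)
    (hle : ∀ u ∈ S, ∀ v ∈ S, lineDist y z u v ≤ |(v : ℝ) - u|) :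
    TotallyBounded (toPreTree h '' S) := by
  rw [Metric.totallyBounded_iff]
  intro ε hε
  obtain ⟨t, hts, htf, ht⟩ := hS.exists_subset (Metric.dist_mem_uniformity hε)
  refine ⟨toPreTree h '' t, htf.image _, ?_⟩
  rintro _ ⟨v, hv, rfl⟩
  obtain ⟨u, hu, huv⟩ := Set.mem_iUnion₂.1 (ht hv)
  refine Set.mem_iUnion₂.2 ⟨_, Set.mem_image_of_mem _ hu, ?_⟩
  rw [Metric.mem_ball, dist_toPreTree]
  refine lt_of_le_of_lt (hle v hv u (hts hu)) ?_
  rw [abs_sub_comm]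
  exact huv

theorem totallyBounded_Iic (h : IsCutAttach y z) (K : ℕ) :
    TotallyBounded (toPreTree h '' Set.Iic (y K)) := by
  induction K with
  | zero =>
    refine totallyBounded_of_lineDist_le h ?_ fun u hu v hv => lineDist_le_of_le_zero h hu hv
    have h0 : Set.Iic (y 0) = Set.Icc 0 (y 0) := by ext; simp
    rw [h0]
    exact isCompact_Icc.totallyBounded
  | succ K ih =>
    have h1 : TotallyBounded (toPreTree h '' Set.Ioc (y K) (y (K + 1))) :=
      totallyBounded_of_lineDist_le h (isCompact_Icc.totallyBounded.subset Set.Ioc_subset_Icc_self)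
        fun u hu v hv => (lineDist_of_lt_of_lt h hu.1 hu.2 hv.1 hv.2).le
    have h2 := ih.union h1
    rwa [← Set.image_union, Set.Iic_union_Ioc_eq_Iic
      (h.strictMono (Nat.lt_succ_self K)).le] at h2

theorem exists_mem_segment (h : IsCutAttach y z) (v : ℝ≥0) :
    v ≤ y 0 ∨ ∃ k, y k < v ∧ v ≤ y (k + 1) := by
  classical
  have hex : ∃ k, v ≤ y k := (h.tendsto.eventually (eventually_ge_atTop v)).exists
  rcases hk : Nat.find hex with _ | k
  · exact Or.inl (hk ▸ Nat.find_spec hex)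
  · exact Or.inr ⟨k, not_le.1 (Nat.find_min hex (by omega)), hk ▸ Nat.find_spec hex⟩

/-- The part up to `y K` is a finite union of intervals on which the metric is at most the usual
one, hence totally bounded. If such parts are `ε`-dense for every `ε`, the whole half-line is
totally bounded, and its completion is compact. -/
theorem compactSpace_tree_of_approx (h : IsCutAttach y z)
    (happ : ∀ ε : ℝ, 0 < ε → ∃ K, ∀ v, ∃ w ≤ y K, lineDist y z w v < ε) :
    CompactSpace (Tree h) := by
  have htb : TotallyBounded (Set.univ : Set (PreTree h)) := by
    rw [Metric.totallyBounded_iff]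
    intro ε hε
    obtain ⟨K, hK⟩ := happ (ε / 2) (by positivity)
    obtain ⟨t, htf, ht⟩ := Metric.totallyBounded_iff.1 (totallyBounded_Iic h K) (ε / 2)
      (by positivity)
    refine ⟨t, htf, fun v _ => ?_⟩
    obtain ⟨v, rfl⟩ := toPreTree_surjective h v
    obtain ⟨w, hw, hwv⟩ := hK v
    obtain ⟨u, hu, hwu⟩ := Set.mem_iUnion₂.1 (ht (Set.mem_image_of_mem _ hw))
    refine Set.mem_iUnion₂.2 ⟨u, hu, ?_⟩
    rw [Metric.mem_ball] at hwu ⊢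
    rw [← dist_toPreTree h] at hwv
    have h3 := dist_triangle_left (toPreTree h v) u (toPreTree h w)
    linarith
  have h1 := (htb.image (UniformSpace.Completion.uniformContinuous_coe (PreTree h))).closure
  rw [Set.image_univ, UniformSpace.Completion.denseRange_coe.closure_range] at h1
  exact ⟨isCompact_iff_totallyBounded_isComplete.2 ⟨h1, isComplete_univ⟩⟩

/-- Let `x` be a nondecreasing sequence attached to the cut points and let `a m k` be the value
of `x` at the `m`-th ancestor of `k`. If the values decrease fast enough along the lines of
ancestors, in comparison with the lengths of the segments, then the tree is compact. -/
theorem compactSpace_tree (h : IsCutAttach y z) {x : ℕ → ℝ≥0∞} {a : ℕ → ℕ → ℝ≥0∞}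
    (ha : ∀ k, a 0 k = x k) (hx : Monotone x) (hxtop : ∀ k, x k < ∞)
    (hpar : ∀ k, z k ≤ y 0 ∨
      ∃ j < k, y j < z k ∧ z k ≤ y (j + 1) ∧ ∀ m, a (m + 1) k = a m j)
    {m : ℕ → ℕ} (hm : Monotone m) (hchain : ∀ᶠ k in atTop, a (m k) k < x k / 4)
    {δ : ℕ → ℝ} (hδ : ∀ n, 0 ≤ δ n)
    (hgap : ∀ᶠ n in atTop, ∀ k, 4 ^ n ≤ x k → x k < 4 ^ (n + 1) → (y (k + 1) : ℝ) - y k ≤ δ n)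
    {N : ℕ → ℕ} (hN : ∀ᶠ n in atTop, ∀ k, x k < 4 ^ (n + 1) → k < N n)
    (hsum : Summable fun n => m (N n) * δ n) : CompactSpace (Tree h) := by
  refine compactSpace_tree_of_approx h fun ε hε => ?_
  -- The levels from `n₀` on cost less than `ε` in total. The index `K` is so large that every later
  -- segment has level at least `n₀` and satisfies the chain bound.
  obtain ⟨s, hs⟩ := summable_iff_vanishing_norm.1 hsum ε hε
  obtain ⟨n₁, hn₁⟩ := eventually_atTop.1 (hgap.and hN)
  set n₀ := max n₁ (s.sup id + 1) with hn₀
  obtain ⟨k₁, hk₁⟩ := eventually_atTop.1 hchain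
  set K := max k₁ (N n₀) with hKdef
  have hKx : ∀ k, x k < 4 ^ n₀ → k < K := fun k hk => by
    refine lt_of_lt_of_le ((hn₁ n₀ (le_max_left _ _)).2 k (hk.trans_le ?_)) (le_max_right _ _)
    exact pow_le_pow_right₀ (by norm_num) (Nat.le_succ _)
  set B : ℕ → ℝ := fun n => ∑ i ∈ Finset.Ico n₀ n, m (N i) * δ i with hB
  have hterm : ∀ i, 0 ≤ m (N i) * δ i := fun i => mul_nonneg (Nat.cast_nonneg _) (hδ i)
  have hB0 : ∀ n, 0 ≤ B n := fun n => Finset.sum_nonneg fun i _ => hterm i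
  have hBε : ∀ n, B n < ε := by
    intro n
    refine lt_of_le_of_lt (le_abs_self _) (hs _ (Finset.disjoint_left.2 fun i hi his => ?_))
    have h1 := (Finset.mem_Ico.1 hi).1
    have h2 : i ≤ s.sup id := Finset.le_sup (f := id) his
    omega
  have hsmall : ∀ k < K, ∀ v ≤ y (k + 1), v ≤ y K := fun k hk v hv =>
    hv.trans (h.strictMono.monotone hk)
  -- Here `B n` is the cost of descending through the levels `n₀, …, n - 1`.
  have main : ∀ n, n₀ ≤ n → ∀ k, x k < 4 ^ n → ∀ v, y k < v → v ≤ y (k + 1) →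
      ∃ w ≤ y K, lineDist y z w v ≤ B n := by
    intro n hn
    induction n, hn using Nat.le_induction with
    | base =>
      intro k hk v _ hv'
      exact ⟨v, hsmall k (hKx k hk) v hv', by rw [lineDist_self]; exact hB0 _⟩
    | succ n hn ih =>
      have hnn : n₁ ≤ n := (le_max_left _ _).trans hn
      -- If the `i`-th ancestor lies below level `n`, at most `i` segments of level `n` are crossed,
      -- each of length at most `δ n`. A missing ancestor has value `0` in the application; the walk
      -- then ends in the initial segment.
      have inner : ∀ i k, x k < 4 ^ (n + 1) → a i k < 4 ^ n → ∀ v, y k < v → v ≤ y (k + 1) →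
          ∃ w ≤ y K, lineDist y z w v ≤ B n + i * δ n := by
        intro i
        induction i with
        | zero =>
          intro k _ hk v hv hv'
          simpa using ih k (ha k ▸ hk) v hv hv'
        | succ i ih' =>
          intro k hk hak v hv hv'
          have hi : 0 ≤ (i : ℝ) * δ n := mul_nonneg (Nat.cast_nonneg _) (hδ n)
          have hcast : ((i + 1 : ℕ) : ℝ) * δ n = i * δ n + δ n := by push_cast; ring
          rw [hcast]
          have hδn := hδ n
          have hBn := hB0 n
          rcases lt_or_ge (x k) (4 ^ n) with hxk | hxk
          · obtain ⟨w, hw, hwv⟩ := ih k hxk v hv hv'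
            exact ⟨w, hw, by linarith⟩
          rcases lt_or_ge k K with hkK | hkK
          · exact ⟨v, hsmall k hkK v hv', by rw [lineDist_self]; linarith⟩
          have hlen : (v : ℝ) - y k ≤ δ n := by
            refine le_trans ?_ ((hn₁ n hnn).1 k hxk hk)
            gcongr
          have hyk : y K ≤ y k := h.strictMono.monotone hkK
          rcases hpar k with h0 | ⟨j, hjk, hj1, hj2, hj3⟩
          · refine ⟨z k, h0.trans (h.strictMono.monotone (Nat.zero_le K)), ?_⟩
            rw [lineDist_of_le_of_lt h (h.lt k).le hv hv', lineDist_self]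
            linarith
          · obtain ⟨w, hw, hwz⟩ := ih' j ((hx hjk.le).trans_lt hk) (hj3 i ▸ hak) (z k) hj1 hj2
            refine ⟨w, hw, ?_⟩
            rw [lineDist_of_le_of_lt h (hw.trans hyk) hv hv']
            linarith
      intro k hk v hv hv'
      rcases lt_or_ge k K with hkK | hkK
      · exact ⟨v, hsmall k hkK v hv', by rw [lineDist_self]; exact hB0 _⟩
      -- Dividing `x k` by 4 lowers the level by one, so `m k` generations suffice to leave level
      -- `n`.
      have hak : a (m k) k < 4 ^ n := by
        refine (hk₁ k ((le_max_left _ _).trans hkK)).trans ?_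
        rw [ENNReal.div_lt_iff (Or.inl (by norm_num)) (Or.inl (by norm_num)), ← pow_succ]
        exact hk
      obtain ⟨w, hw, hwv⟩ := inner (m k) k hk hak v hv hv'
      refine ⟨w, hw, hwv.trans ?_⟩
      have hBs : B (n + 1) = B n + m (N n) * δ n := Finset.sum_Ico_succ_top hn _
      rw [hBs]
      have : (m k : ℝ) ≤ m (N n) := by exact_mod_cast hm ((hn₁ n hnn).2 k hk).le
      have := mul_le_mul_of_nonneg_right this (hδ n)
      linarith
  refine ⟨K, fun v => ?_⟩
  rcases exists_mem_segment h v with h0 | ⟨k, hk, hk'⟩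
  · exact ⟨v, h0.trans (h.strictMono.monotone (Nat.zero_le K)), by rw [lineDist_self]; exact hε⟩
  · obtain ⟨n, hn⟩ : ∃ n : ℕ, x k < 4 ^ n := by
      have := (ENNReal.tendsto_pow_atTop_nhds_top_iff.2 (show (1 : ℝ≥0∞) < 4 by norm_num)).eventually
        (lt_mem_nhds (hxtop k))
      exact this.exists
    obtain ⟨w, hw, hwv⟩ := main (max n n₀) (le_max_right _ _) k
      (hn.trans_le (pow_le_pow_right₀ (by norm_num) (le_max_left _ _))) v hk hk'
    exact ⟨w, hw, hwv.trans_lt (hBε _)⟩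

end Compactness

/-! ### Path properties and tail bounds of the intensity process -/

section Intensity

open Filter

theorem lebesgue_apply {s : Set ℝ≥0} : lebesgue s = volume ((↑) '' s : Set ℝ) :=
  (MeasurableEmbedding.subtype_coe measurableSet_Ici).comap_apply _ _

theorem lebesgue_Icc (a b : ℝ≥0) : lebesgue (Set.Icc a b) = ENNReal.ofReal (b - a) := by
  have h : ((↑) '' Set.Icc a b : Set ℝ) = Set.Icc (a : ℝ) b := by
    ext x
    simp only [Set.mem_image, Set.mem_Icc]
    constructor
    · rintro ⟨u, ⟨h1, h2⟩, rfl⟩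
      exact ⟨by exact_mod_cast h1, by exact_mod_cast h2⟩
    · rintro ⟨h1, h2⟩
      exact ⟨⟨x, a.2.trans h1⟩, ⟨by exact_mod_cast h1, by exact_mod_cast h2⟩, rfl⟩
  rw [lebesgue_apply, h, Real.volume_Icc]

theorem lebesgue_Ico (a b : ℝ≥0) : lebesgue (Set.Ico a b) = ENNReal.ofReal (b - a) := by
  have h : ((↑) '' Set.Ico a b : Set ℝ) = Set.Ico (a : ℝ) b := by
    ext x
    simp only [Set.mem_image, Set.mem_Ico]
    constructor
    · rintro ⟨u, ⟨h1, h2⟩, rfl⟩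
      exact ⟨by exact_mod_cast h1, by exact_mod_cast h2⟩
    · rintro ⟨h1, h2⟩
      exact ⟨⟨x, a.2.trans h1⟩, ⟨by exact_mod_cast h1, by exact_mod_cast h2⟩, rfl⟩
  rw [lebesgue_apply, h, Real.volume_Ico]

theorem lebesgue_Iic (t : ℝ≥0) : lebesgue (Set.Iic t) = ENNReal.ofReal t := by
  have h : Set.Iic t = Set.Icc 0 t := by ext; simp
  rw [h, lebesgue_Icc]
  simp

variable {Ω Ω' : Type*} [MeasurableSpace Ω] [MeasurableSpace Ω'] {α : ℝ} {p : ℝ → ℝ}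
  {P' : Measure Ω'} {σ : ℝ≥0 → Ω' → ℝ} {P : Measure Ω} {τ : ℝ≥0 → Ω → ℝ}

theorem IsStableSubordinator.ae_nonneg (hσ : IsStableSubordinator α σ P') :
    ∀ᵐ ω ∂P', ∀ t, 0 ≤ σ t ω := by
  filter_upwards [hσ.zero, hσ.monotone] with ω h0 hm t
  have : σ 0 ω ≤ σ t ω := hm zero_le
  rwa [h0] at this

theorem IsStableSubordinator.measureReal_le (hσ : IsStableSubordinator α σ P')
    [IsProbabilityMeasure P'] (t : ℝ≥0) {l : ℝ} (hl : 0 ≤ l) (x : ℝ) :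
    P'.real {ω | σ t ω ≤ x} ≤ Real.exp (l * x - t * α * l ^ (α - 1)) := by
  have hint : Integrable (fun ω => Real.exp (-l * σ t ω)) P' := by
    -- A non-integrable function would have integral `0`, but the prescribed Laplace transform is
    -- positive.
    by_contra h
    have := hσ.laplace t l hl
    rw [integral_undef h] at this
    exact (Real.exp_pos _).ne this
  refine (measure_le_le_exp_mul_mgf x (neg_nonpos.2 hl) hint).trans (le_of_eq ?_)
  rw [mgf, hσ.laplace t l hl, ← Real.exp_add]
  congr 1
  ring

/-- Let `l → ∞` in the Chernoff bound at `x = 0`; the exponent `α - 1` is positive. -/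
theorem IsStableSubordinator.ae_pos (hσ : IsStableSubordinator α σ P') [IsProbabilityMeasure P']
    (hα : 1 < α) {t : ℝ≥0} (ht : 0 < t) : ∀ᵐ ω ∂P', 0 < σ t ω := by
  have h1 : Tendsto (fun l : ℝ => Real.exp (-(t * α * l ^ (α - 1)))) atTop (nhds 0) := by
    refine Real.tendsto_exp_neg_atTop_nhds_zero.comp ?_
    exact (tendsto_rpow_atTop (by linarith)).const_mul_atTop
      (mul_pos (by exact_mod_cast ht) (by linarith))
  have h2 : P'.real {ω | σ t ω ≤ 0} ≤ 0 := by
    refine ge_of_tendsto h1 ?_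
    filter_upwards [eventually_ge_atTop 0] with l hl
    simpa using hσ.measureReal_le t hl 0
  rw [ae_iff]
  simp only [not_lt]
  exact (measureReal_eq_zero_iff).1 (le_antisymm h2 measureReal_nonneg)

theorem IsMeasureChange.measure_eq (hτ : IsMeasureChange p σ P' τ P)
    (hσ : ∀ t, Measurable (σ t)) (t : ℝ≥0) {B : Set (Set.Iic t → ℝ)} (hB : MeasurableSet B) :
    P {ω | (fun s : Set.Iic t => τ s ω) ∈ B} =
      ∫⁻ ω in {ω | (fun s : Set.Iic t => σ s ω) ∈ B},
        ENNReal.ofReal (changeDensity p σ t ω) ∂P' := by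
  have hτm : Measurable fun ω (s : Set.Iic t) => τ s ω :=
    measurable_pi_lambda _ fun s => hτ.measurable s
  have hσm : Measurable fun ω (s : Set.Iic t) => σ s ω :=
    measurable_pi_lambda _ fun s => hσ s
  have h := congrArg (fun μ : Measure (Set.Iic t → ℝ) => μ B) (hτ.law t)
  simp only [Measure.map_apply hτm hB, Measure.map_apply hσm hB] at h
  rw [withDensity_apply _ (hσm hB)] at h
  exact h

theorem IsMeasureChange.measure_le (hτ : IsMeasureChange p σ P' τ P)
    (hσ : ∀ t, Measurable (σ t)) {t : ℝ≥0} {B : Set (Set.Iic t → ℝ)} (hB : MeasurableSet B)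
    {c : ℝ≥0∞} (h : ∀ᵐ ω ∂P', (fun s : Set.Iic t => σ s ω) ∈ B →
      ENNReal.ofReal (changeDensity p σ t ω) ≤ c) :
    P {ω | (fun s : Set.Iic t => τ s ω) ∈ B} ≤
      c * P' {ω | (fun s : Set.Iic t => σ s ω) ∈ B} := by
  have hσm : Measurable fun ω (s : Set.Iic t) => σ s ω :=
    measurable_pi_lambda _ fun s => hσ s
  rw [hτ.measure_eq hσ t hB, ← setLIntegral_const]
  exact setLIntegral_mono_ae' (hσm hB) h

/-- Local absolute continuity: almost sure properties of `σ` on a bounded time interval pass to `τ`.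
-/
theorem IsMeasureChange.measure_eq_zero (hτ : IsMeasureChange p σ P' τ P)
    (hσ : ∀ t, Measurable (σ t)) {t : ℝ≥0} {B : Set (Set.Iic t → ℝ)} (hB : MeasurableSet B)
    (h : P' {ω | (fun s : Set.Iic t => σ s ω) ∈ B} = 0) :
    P {ω | (fun s : Set.Iic t => τ s ω) ∈ B} = 0 := by
  rw [hτ.measure_eq hσ t hB, Measure.restrict_eq_zero.2 h, lintegral_zero_measure]

/-- The time `q`, for rational `q`. -/
noncomputable def ratTime (q : ℚ) : ℝ≥0 := Real.toNNReal q

theorem exists_ratTime_between {s t : ℝ≥0} (h : s < t) : ∃ q, s < ratTime q ∧ ratTime q < t := by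
  obtain ⟨q, -, h1, h2⟩ := (NNReal.lt_iff_exists_rat_btwn s t).1 h
  exact ⟨q, h1, h2⟩

/-- By right-continuity, a strict inversion `f t < f s` persists just after `s` and `t`, hence at
rational times. Only countably many comparisons are then needed almost surely. -/
theorem IsCadlag.monotone {f : ℝ≥0 → ℝ} (hf : IsCadlag f)
    (h : ∀ q r, ratTime q ≤ ratTime r → f (ratTime q) ≤ f (ratTime r)) : Monotone f := by
  intro s t hst
  by_contra! hlt
  obtain ⟨c, hc1, hc2⟩ := exists_between hlt
  have hs : ∀ᶠ u in nhdsWithin s (Set.Ioi s), c < f u :=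
    ((hf s).1.mono Set.Ioi_subset_Ici_self).eventually (lt_mem_nhds hc2)
  have ht : ∀ᶠ u in nhdsWithin t (Set.Ioi t), f u < c :=
    ((hf t).1.mono Set.Ioi_subset_Ici_self).eventually (gt_mem_nhds hc1)
  obtain ⟨a, ha, ha'⟩ := mem_nhdsGT_iff_exists_Ioo_subset.1 hs
  obtain ⟨b, hb, hb'⟩ := mem_nhdsGT_iff_exists_Ioo_subset.1 ht
  obtain ⟨r, hr1, hr2⟩ := exists_ratTime_between (show t < b from hb)
  obtain ⟨q, hq1, hq2⟩ := exists_ratTime_between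
    (show s < min a (ratTime r) from lt_min ha (hst.trans_lt hr1))
  have h1 : c < f (ratTime q) := ha' ⟨hq1, hq2.trans_le (min_le_left _ _)⟩
  have h2 : f (ratTime r) < c := hb' ⟨hr1, hr2⟩
  exact absurd (h q r (hq2.trans_le (min_le_right _ _)).le) (not_le.2 (h2.trans h1))

theorem IsMeasureChange.ae_monotone (hτ : IsMeasureChange p σ P' τ P)
    (hσ : IsStableSubordinator α σ P') : ∀ᵐ ω ∂P, Monotone fun t => τ t ω := by
  have h : ∀ s t : ℝ≥0, s ≤ t → ∀ᵐ ω ∂P, τ s ω ≤ τ t ω := by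
    intro s t hst
    rw [ae_iff]
    refine hτ.measure_eq_zero hσ.measurable (t := t)
      (B := {f | ¬f ⟨s, Set.mem_Iic.2 hst⟩ ≤ f ⟨t, Set.self_mem_Iic⟩})
      (measurableSet_le (measurable_pi_apply (⟨s, Set.mem_Iic.2 hst⟩ : Set.Iic t)) (measurable_pi_apply (⟨t, Set.self_mem_Iic⟩ : Set.Iic t))).compl ?_
    refine (ae_iff (p := fun ω => σ s ω ≤ σ t ω)).1 ?_
    filter_upwards [hσ.monotone] with ω hω using hω hst
  have h2 : ∀ᵐ ω ∂P, ∀ q r, ratTime q ≤ ratTime r → τ (ratTime q) ω ≤ τ (ratTime r) ω := by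
    simp only [ae_all_iff]
    exact fun q r hqr => h _ _ hqr
  filter_upwards [h2, hτ.cadlag] with ω h3 h4 using h4.monotone h3

theorem IsMeasureChange.ae_nonneg (hτ : IsMeasureChange p σ P' τ P)
    (hσ : IsStableSubordinator α σ P') : ∀ᵐ ω ∂P, ∀ t, 0 ≤ τ t ω := by
  have h : ∀ᵐ ω ∂P, 0 ≤ τ 0 ω := by
    rw [ae_iff]
    refine hτ.measure_eq_zero hσ.measurable (t := 0) (B := {f | ¬0 ≤ f ⟨0, Set.self_mem_Iic⟩})
      (measurableSet_le measurable_const (measurable_pi_apply (⟨0, Set.self_mem_Iic⟩ : Set.Iic (0 : ℝ≥0)))).compl ?_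
    refine (ae_iff (p := fun ω => 0 ≤ σ 0 ω)).1 ?_
    filter_upwards [hσ.ae_nonneg] with ω hω using hω 0
  filter_upwards [h, hτ.ae_monotone hσ] with ω h1 h2 t
  exact h1.trans (h2 zero_le)

theorem IsMeasureChange.ae_pos (hτ : IsMeasureChange p σ P' τ P)
    (hσ : IsStableSubordinator α σ P') [IsProbabilityMeasure P'] (hα : 1 < α) :
    ∀ᵐ ω ∂P, ∀ t, 0 < t → 0 < τ t ω := by
  have h : ∀ t : ℝ≥0, 0 < t → ∀ᵐ ω ∂P, 0 < τ t ω := by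
    intro t ht
    rw [ae_iff]
    refine hτ.measure_eq_zero hσ.measurable (t := t) (B := {f | ¬0 < f ⟨t, Set.self_mem_Iic⟩})
      (measurableSet_lt measurable_const (measurable_pi_apply (⟨t, Set.self_mem_Iic⟩ : Set.Iic t))).compl ?_
    exact (ae_iff (p := fun ω => 0 < σ t ω)).1 (hσ.ae_pos hα ht)
  have h2 : ∀ᵐ ω ∂P, ∀ q, 0 < ratTime q → 0 < τ (ratTime q) ω := by
    simp only [ae_all_iff]
    exact fun q hq => h _ hq
  filter_upwards [h2, hτ.ae_monotone hσ] with ω h3 h4 t ht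
  obtain ⟨q, hq, hqt⟩ := exists_ratTime_between ht
  exact (h3 q hq).trans_le (h4 hqt.le)

theorem IsStableSubordinator.ae_changeDensity_le (hσ : IsStableSubordinator α σ P')
    (hp : ∀ x, 0 ≤ p x) (t : ℝ≥0) :
    ∀ᵐ ω ∂P', changeDensity p σ t ω ≤ Real.exp (t * σ t ω) * p (-σ t ω) / p 0 := by
  filter_upwards [hσ.ae_nonneg, hσ.monotone] with ω h0 hm
  rw [changeDensity, mul_div_assoc]
  refine mul_le_mul_of_nonneg_right (Real.exp_le_exp.2 ?_) (div_nonneg (hp _) (hp _))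
  have h1 := norm_setIntegral_le_of_norm_le_const (μ := lebesgue) (s := Set.Iic t)
    (f := fun s => σ s ω) (C := σ t ω) (by rw [lebesgue_Iic]; exact ENNReal.ofReal_lt_top)
    (fun s hs => by rw [Real.norm_of_nonneg (h0 s)]; exact hm hs)
  rw [measureReal_def, lebesgue_Iic, ENNReal.toReal_ofReal (NNReal.coe_nonneg t), mul_comm] at h1
  exact (le_abs_self _).trans h1

/-- Bounds on the tails of the marginal laws of the intensity process. -/
theorem IsMeasureChange.exists_measure_le (hτ : IsMeasureChange p σ P' τ P)
    (hσ : IsStableSubordinator α σ P') [IsProbabilityMeasure P'] (hp : IsStableDensity α p)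
    (hα₁ : 1 < α) (hα₂ : α < 2) :
    ∃ K C : ℝ, 0 ≤ C ∧
      (∀ (t : ℝ≥0) (x : ℝ), 0 ≤ x →
        P {ω | τ t ω ≤ x} ≤ ENNReal.ofReal (C * Real.exp (2 * t * x - t * α * t ^ (α - 1)))) ∧
      ∀ (t : ℝ≥0) (x : ℝ),
        P {ω | x < τ t ω} ≤ ENNReal.ofReal (C * Real.exp (K * (t + 1) ^ 2 - x)) := by
  obtain ⟨K, D, hK, hD, hle⟩ := hp.exists_exp_mul_le hα₁ hα₂
  have hp0 := hp.nonneg 0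
  refine ⟨K, max (D * Real.exp K / p 0) (D / p 0), ?_, fun t x hx => ?_, fun t x => ?_⟩
  · exact le_max_of_le_right (by positivity)
  · have hB : MeasurableSet {f : Set.Iic t → ℝ | f ⟨t, Set.self_mem_Iic⟩ ≤ x} :=
      measurableSet_le (measurable_pi_apply _) measurable_const
    -- Where `σ_t ≤ x`, the density is bounded, `p` being bounded on the negative half-line by the
    -- tilt `l = 1`. The Chernoff bound is then applied with parameter `t`.
    have h1 := hτ.measure_le hσ.measurable hB
      (c := ENNReal.ofReal (Real.exp (t * x) * (D * Real.exp K / p 0))) ?_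
    · refine h1.trans ?_
      have h2 : P' {ω | σ t ω ≤ x} ≤ ENNReal.ofReal (Real.exp (t * x - t * α * t ^ (α - 1))) := by
        rw [← ofReal_measureReal]
        exact ENNReal.ofReal_le_ofReal (hσ.measureReal_le t t.2 x)
      refine (mul_le_mul_right h2 _).trans ?_
      rw [← ENNReal.ofReal_mul (by positivity)]
      refine ENNReal.ofReal_le_ofReal ?_
      have h3 : Real.exp (t * x) * (D * Real.exp K / p 0) *
          Real.exp (t * x - t * α * t ^ (α - 1)) =
          (D * Real.exp K / p 0) * Real.exp (2 * t * x - t * α * t ^ (α - 1)) := by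
        rw [mul_right_comm, ← Real.exp_add, mul_comm]
        congr 2
        ring
      rw [h3]
      exact mul_le_mul_of_nonneg_right (le_max_left _ _) (Real.exp_pos _).le
    · filter_upwards [hσ.ae_changeDensity_le hp.nonneg t, hσ.ae_nonneg] with ω h2 h0 hωx
      refine ENNReal.ofReal_le_ofReal (h2.trans ?_)
      rw [mul_div_assoc]
      have h3 := hle 1 le_rfl (-σ t ω)
      have h4 : p (-σ t ω) ≤ D * Real.exp K := by
        refine le_trans ?_ (h3.trans (by simp))
        refine le_mul_of_one_le_left (hp.nonneg _) (Real.one_le_exp ?_)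
        simpa using h0 t
      have h5 : σ t ω ≤ x := hωx
      gcongr
      exact div_nonneg (hp.nonneg _) hp0
  · have hB : MeasurableSet {f : Set.Iic t → ℝ | x < f ⟨t, Set.self_mem_Iic⟩} :=
      measurableSet_lt measurable_const (measurable_pi_apply _)
    -- The tilt `l = t + 1` absorbs `exp (t σ_t)` and leaves a factor `exp (-σ_t) ≤ exp (-x)`. No
    -- tail bound for `σ` is needed.
    have h1 := hτ.measure_le hσ.measurable hB
      (c := ENNReal.ofReal (D / p 0 * Real.exp (K * (t + 1) ^ 2 - x))) ?_
    · refine (h1.trans (mul_le_of_le_one_right' prob_le_one)).trans (ENNReal.ofReal_le_ofReal ?_)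
      exact mul_le_mul_of_nonneg_right (le_max_right _ _) (Real.exp_pos _).le
    · filter_upwards [hσ.ae_changeDensity_le hp.nonneg t] with ω h2 hωx
      refine ENNReal.ofReal_le_ofReal (h2.trans ?_)
      have h3 := hle (t + 1) (by simp) (-σ t ω)
      have h4 : x < σ t ω := hωx
      have h5 : Real.exp (t * σ t ω) * p (-σ t ω) =
          Real.exp (-σ t ω) * (Real.exp (-(t + 1 : ℝ) * -σ t ω) * p (-σ t ω)) := by
        rw [← mul_assoc, ← Real.exp_add]
        congr 2
        ring
      have h6 : Real.exp (-σ t ω) ≤ Real.exp (-x) := Real.exp_le_exp.2 (by linarith)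
      have h7 : Real.exp (t * σ t ω) * p (-σ t ω) ≤
          Real.exp (-x) * (D * Real.exp (K * (t + 1) ^ 2)) := by
        rw [h5]
        exact mul_le_mul h6 h3 (mul_nonneg (Real.exp_pos _).le (hp.nonneg _)) (Real.exp_pos _).le
      refine (div_le_div_of_nonneg_right h7 hp0).trans (le_of_eq ?_)
      rw [sub_eq_add_neg, Real.exp_add]
      ring

end Intensity

/-! ### Counting points of the Cox process -/

section Points

open Filter

variable {Ω : Type*} [MeasurableSpace Ω] {P : Measure Ω} {τ : ℝ≥0 → Ω → ℝ} {Y : ℕ → Ω → ℝ≥0}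

theorem ae_eventually_notMem_of_summable [IsProbabilityMeasure P] {s : ℕ → Set Ω} {g : ℕ → ℝ}
    (hg : Summable g) (h : ∀ᶠ n in atTop, P (s n) ≤ ENNReal.ofReal (g n)) :
    ∀ᵐ ω ∂P, ∀ᶠ n in atTop, ω ∉ s n := by
  obtain ⟨k, hk⟩ := eventually_atTop.1 h
  have hsum : ∑' n, P (s (n + k)) ≠ ∞ := by
    refine ne_top_of_le_ne_top ((summable_nat_add_iff k).2 hg).tsum_ofReal_ne_top
      (ENNReal.tsum_le_tsum fun n => hk _ (Nat.le_add_left _ _))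
  filter_upwards [ae_eventually_notMem hsum] with ω hω
  rw [← map_add_atTop_eq_nat k]
  exact hω

/-- The multiple `(k + 1) / (n + 1)` of `1 / (n + 1)`. -/
noncomputable def gridPoint (n k : ℕ) : ℝ≥0 := ((k + 1 : ℕ) : ℝ≥0) / (n + 1)

/-- The first multiple of `1 / (n + 1)` after `s`. -/
noncomputable def gridApprox (n : ℕ) (s : ℝ≥0) : ℝ≥0 := gridPoint n ⌊(n + 1 : ℝ≥0) * s⌋₊

theorem tendsto_gridApprox (s : ℝ≥0) :
    Tendsto (fun n => gridApprox n s) atTop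
      (nhdsWithin s (Set.Ici s)) := by
  have hlt : ∀ n, s ≤ gridApprox n s := by
    intro n
    unfold gridApprox gridPoint
    rw [le_div_iff₀ (by positivity), mul_comm]
    push_cast
    exact (Nat.lt_floor_add_one _).le
  refine tendsto_nhdsWithin_iff.2 ⟨?_, Eventually.of_forall hlt⟩
  have hle : ∀ n, gridApprox n s ≤ s + 1 / ((n : ℝ≥0) + 1) := by
    intro n
    unfold gridApprox gridPoint
    have h1 : (s + 1 / ((n : ℝ≥0) + 1)) * (n + 1) = (n + 1) * s + 1 := by field_simp
    rw [div_le_iff₀ (by positivity), h1]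
    push_cast
    gcongr
    exact Nat.floor_le zero_le
  refine tendsto_of_tendsto_of_tendsto_of_le_of_le tendsto_const_nhds ?_ hlt hle
  have := (tendsto_one_div_add_atTop_nhds_zero_nat (𝕜 := ℝ≥0)).const_add s
  rwa [add_zero] at this

/-- Discretizing time from the right gives jointly measurable processes, converging to `τ` on càdlàg
paths. Their `limsup` is a jointly measurable version, to which Fubini applies. -/
theorem aemeasurable_setIntegral (hm : ∀ t, Measurable (τ t))
    (hc : ∀ᵐ ω ∂P, IsCadlag fun t => τ t ω) (B : Set ℝ≥0) [SigmaFinite (lebesgue.restrict B)] :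
    AEMeasurable (fun ω => ∫ s in B, τ s ω ∂lebesgue) P := by
  set f : ℕ → Ω × ℝ≥0 → ℝ := fun n q => τ (gridApprox n q.2) q.1
  have hfm : ∀ n, Measurable (f n) := by
    intro n
    have h1 : Measurable fun q : Ω × ℕ => τ (gridPoint n q.2) q.1 :=
      measurable_from_prod_countable_left fun k => hm (gridPoint n k)
    have h2 : Measurable fun q : Ω × ℝ≥0 => (q.1, ⌊(n + 1 : ℝ≥0) * q.2⌋₊) :=
      measurable_fst.prodMk (Nat.measurable_floor.comp (measurable_snd.const_mul _))
    have h3 := h1.comp h2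
    exact h3
  have hg : Measurable fun q => limsup (fun n => f n q) atTop := Measurable.limsup hfm
  refine ⟨fun ω => ∫ s in B, limsup (fun n => f n (ω, s)) atTop ∂lebesgue,
    (hg.stronglyMeasurable.integral_prod_right (ν := lebesgue.restrict B)).measurable, ?_⟩
  filter_upwards [hc] with ω hω
  congr 1 with s
  have h : Tendsto (fun n => τ (gridApprox n s) ω) atTop (nhds (τ s ω)) :=
    (hω s).1.tendsto.comp (tendsto_gridApprox s)
  exact h.limsup_eq.symm

theorem isFiniteMeasure_restrict_lebesgue {B : Set ℝ≥0} (hB : BddAbove B) :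
    IsFiniteMeasure (lebesgue.restrict B) := by
  obtain ⟨b, hb⟩ := hB
  refine ⟨?_⟩
  rw [Measure.restrict_apply_univ]
  refine (measure_mono (show B ⊆ Set.Iic b from fun x hx => hb hx)).trans_lt ?_
  rw [lebesgue_Iic]
  exact ENNReal.ofReal_lt_top

theorem integrableOn_of_monotone {f : ℝ≥0 → ℝ} (hf : Monotone f) (h0 : ∀ t, 0 ≤ f t)
    {B : Set ℝ≥0} (hBm : MeasurableSet B) (hB : BddAbove B) : IntegrableOn f B lebesgue := by
  have := isFiniteMeasure_restrict_lebesgue hB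
  obtain ⟨b, hb⟩ := hB
  refine Integrable.of_bound (C := f b) hf.measurable.aestronglyMeasurable ?_
  filter_upwards [ae_restrict_mem hBm] with s hs
  rw [Real.norm_of_nonneg (h0 s)]
  exact hf (hb hs)

theorem setIntegral_Iic_le {f : ℝ≥0 → ℝ} (hf : Monotone f) (h0 : ∀ t, 0 ≤ f t) (t : ℝ≥0) :
    ∫ s in Set.Iic t, f s ∂lebesgue ≤ t * f t := by
  have h1 := norm_setIntegral_le_of_norm_le_const (μ := lebesgue) (s := Set.Iic t)
    (f := f) (C := f t) (by rw [lebesgue_Iic]; exact ENNReal.ofReal_lt_top)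
    (fun s hs => by rw [Real.norm_of_nonneg (h0 s)]; exact hf hs)
  rw [measureReal_def, lebesgue_Iic, ENNReal.toReal_ofReal (NNReal.coe_nonneg t), mul_comm] at h1
  exact (le_abs_self _).trans h1

theorem le_setIntegral_Ico {f : ℝ≥0 → ℝ} (hf : Monotone f) (h0 : ∀ t, 0 ≤ f t) (s d : ℝ≥0) :
    d * f s ≤ ∫ u in Set.Ico s (s + d), f u ∂lebesgue := by
  have hfin := isFiniteMeasure_restrict_lebesgue (bddAbove_Ico (a := s) (b := s + d))
  have h1 : ∫ _ in Set.Ico s (s + d), f s ∂lebesgue = d * f s := by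
    rw [setIntegral_const, measureReal_def, lebesgue_Ico]
    simp
  rw [← h1]
  exact setIntegral_mono_on (integrable_const _)
    (integrableOn_of_monotone hf h0 measurableSet_Ico bddAbove_Ico) measurableSet_Ico
    fun u hu => hf hu.1

theorem tsum_poissonMeasure_singleton (r : ℝ≥0) : ∑' m : ℕ, poissonMeasure r {m} = 1 := by
  have h := measure_iUnion (μ := poissonMeasure r) (f := fun m : ℕ => ({m} : Set ℕ))
    (fun i j hij => by simpa using hij) fun m => measurableSet_singleton m
  rw [← h, Set.iUnion_of_singleton, measure_univ]

/-- Consecutive weights have ratio `r / (m + 1)`. Comparing counts `m + 1` and `m` under the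
conditional law yields a tail bound. -/
theorem poissonMeasure_succ_le {r : ℝ≥0} {c : ℝ} (hr : r ≤ c) {K m : ℕ} (hm : K ≤ m) :
    poissonMeasure r {m + 1} ≤ ENNReal.ofReal (c / (K + 1)) * poissonMeasure r {m} := by
  have hc : 0 ≤ c := r.2.trans hr
  rw [poissonMeasure_singleton, poissonMeasure_singleton, ← ENNReal.ofReal_mul (by positivity)]
  refine ENNReal.ofReal_le_ofReal ?_
  have h1 : Real.exp (-r) * r ^ (m + 1) / (m + 1).factorial =
      (r / (m + 1)) * (Real.exp (-r) * r ^ m / m.factorial) := by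
    rw [Nat.factorial_succ]
    push_cast
    field_simp
    ring
  rw [h1]
  gcongr

theorem IsCoxPoints.count_one (hY : IsCoxPoints τ Y P) {A : Set (ℝ≥0 → ℝ)} (hA : MeasurableSet A)
    {B : Set ℝ≥0} (hBm : MeasurableSet B) (hB : BddAbove B) (m : ℕ) :
    P {ω | (fun t => τ t ω) ∈ A ∧ {k | Y k ω ∈ B}.encard = m} =
      ∫⁻ ω in {ω | (fun t => τ t ω) ∈ A},
        poissonMeasure (∫ s in B, τ s ω ∂lebesgue).toNNReal {m} ∂P := by
  simpa using hY.count A hA 1 (fun _ => B) (fun _ => hBm) (fun _ => hB)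
    (fun i j hij => absurd (Subsingleton.elim i j) hij) fun _ => m

theorem aemeasurable_poissonMeasure (hm : ∀ t, Measurable (τ t))
    (hc : ∀ᵐ ω ∂P, IsCadlag fun t => τ t ω) {B : Set ℝ≥0} (hB : BddAbove B) (m : ℕ) :
    AEMeasurable (fun ω => poissonMeasure (∫ s in B, τ s ω ∂lebesgue).toNNReal {m}) P := by
  have := isFiniteMeasure_restrict_lebesgue hB
  simp only [poissonMeasure_singleton]
  have h := (aemeasurable_setIntegral hm hc B).real_toNNReal.coe_nnreal_real
  exact (((Real.measurable_exp.comp_aemeasurable h.neg).mul (h.pow_const m)).div_const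
    _).ennreal_ofReal

/-- Poisson weights sum to `1`, so no mass is left for an infinite number of points in `B`. -/
theorem IsCoxPoints.tsum_measure_count (hY : IsCoxPoints τ Y P) (hm : ∀ t, Measurable (τ t))
    (hc : ∀ᵐ ω ∂P, IsCadlag fun t => τ t ω) {A : Set (ℝ≥0 → ℝ)} (hA : MeasurableSet A)
    {B : Set ℝ≥0} (hBm : MeasurableSet B) (hB : BddAbove B) :
    ∑' m : ℕ, P {ω | (fun t => τ t ω) ∈ A ∧ {k | Y k ω ∈ B}.encard = m} =
      P {ω | (fun t => τ t ω) ∈ A} := by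
  simp only [hY.count_one hA hBm hB]
  rw [← lintegral_tsum fun m => (aemeasurable_poissonMeasure hm hc hB m).restrict]
  simp [tsum_poissonMeasure_singleton]

/-- The indices of the points up to `t` form an initial segment. The right side involves single
points only and is visibly measurable. -/
theorem encard_le_eq_iff {y : ℕ → ℝ≥0} (hy : StrictMono y) (t : ℝ≥0) (m : ℕ) :
    {k | y k ∈ Set.Iic t}.encard = m ↔ t < y m ∧ ∀ k < m, y k ≤ t := by
  constructor
  · intro h
    have hfin : {k | y k ∈ Set.Iic t}.Finite := Set.finite_of_encard_eq_coe h
    have hex : ∃ k, t < y k := by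
      by_contra! hall
      have : {k | y k ∈ Set.Iic t} = Set.univ := Set.eq_univ_of_forall hall
      rw [this] at hfin
      exact Set.infinite_univ hfin
    classical
    have hset : {k | y k ∈ Set.Iic t} = Set.Iio (Nat.find hex) := by
      ext k
      constructor
      · intro hk
        by_contra hle
        exact absurd ((Nat.find_spec hex).trans_le (hy.monotone (not_lt.1 hle)))
          (not_lt.2 hk)
      · exact fun hk => not_lt.1 (Nat.find_min hex hk)
    rw [hset, ← Finset.coe_Iio, Set.encard_coe_eq_coe_finsetCard, Nat.card_Iio] at h
    have h' : Nat.find hex = m := by exact_mod_cast h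
    exact ⟨h' ▸ Nat.find_spec hex, fun k hk => not_lt.1 (Nat.find_min hex (h' ▸ hk))⟩
  · rintro ⟨h1, h2⟩
    have hset : {k | y k ∈ Set.Iic t} = Set.Iio m := by
      ext k
      constructor
      · intro hk
        by_contra hle
        exact absurd (h1.trans_le (hy.monotone (not_lt.1 hle))) (not_lt.2 hk)
      · exact fun hk => h2 k hk
    rw [hset, ← Finset.coe_Iio, Set.encard_coe_eq_coe_finsetCard, Nat.card_Iio]

theorem IsCoxPoints.ae_exists_lt [IsProbabilityMeasure P] (hY : IsCoxPoints τ Y P)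
    (hm : ∀ t, Measurable (τ t)) (hc : ∀ᵐ ω ∂P, IsCadlag fun t => τ t ω) (t : ℝ≥0) :
    ∀ᵐ ω ∂P, ∃ k, t < Y k ω := by
  set E : ℕ → Set Ω := fun m => {ω | t < Y m ω ∧ ∀ k < m, Y k ω ≤ t} with hE
  have hEm : ∀ m, MeasurableSet (E m) := by
    intro m
    have : E m = {ω | t < Y m ω} ∩ ⋂ k, ⋂ (_ : k < m), {ω | Y k ω ≤ t} := by ext; simp [hE]
    rw [this]
    exact (measurableSet_lt measurable_const (hY.measurable m)).inter
      (MeasurableSet.iInter fun k => MeasurableSet.iInter fun _ =>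
        measurableSet_le (hY.measurable k) measurable_const)
  have hdisj : Pairwise (fun i j => Disjoint (E i) (E j)) := by
    refine (pairwise_disjoint_on E).2 fun i j hij => Set.disjoint_left.2 fun ω hi hj => ?_
    exact absurd hi.1 (not_lt.2 (hj.2 i hij))
  have h1 : P (⋃ m, E m) = 1 := by
    rw [measure_iUnion hdisj hEm]
    have h2 := hY.tsum_measure_count hm hc MeasurableSet.univ (B := Set.Iic t)
      measurableSet_Iic bddAbove_Iic
    simp only [Set.mem_univ, true_and, Set.ofPred_true, measure_univ] at h2
    rw [← h2]
    refine tsum_congr fun m => measure_congr ?_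
    filter_upwards [hY.strictMono] with ω hω
    exact propext (encard_le_eq_iff hω t m).symm
  have h3 : ∀ᵐ ω ∂P, ω ∈ ⋃ m, E m := by
    rw [ae_mem_iff_measure_eq (MeasurableSet.iUnion hEm).nullMeasurableSet, h1, measure_univ]
  filter_upwards [h3] with ω hω
  obtain ⟨m, hm⟩ := Set.mem_iUnion.1 hω
  exact ⟨m, hm.1⟩

theorem IsCoxPoints.ae_tendsto [IsProbabilityMeasure P] (hY : IsCoxPoints τ Y P)
    (hm : ∀ t, Measurable (τ t)) (hc : ∀ᵐ ω ∂P, IsCadlag fun t => τ t ω) :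
    ∀ᵐ ω ∂P, Tendsto (fun k => Y k ω) atTop atTop := by
  have h : ∀ᵐ ω ∂P, ∀ n : ℕ, ∃ k, (n : ℝ≥0) < Y k ω :=
    ae_all_iff.2 fun n => hY.ae_exists_lt hm hc n
  filter_upwards [h, hY.strictMono] with ω h1 h2
  refine tendsto_atTop_atTop_of_monotone h2.monotone fun b => ?_
  obtain ⟨n, hn⟩ := exists_nat_ge b
  obtain ⟨k, hk⟩ := h1 n
  exact ⟨k, hn.trans hk.le⟩

/-- The count in the Lebesgue-null set `{0}` is Poisson with parameter `0`. -/
theorem IsCoxPoints.ae_pos [IsProbabilityMeasure P] (hY : IsCoxPoints τ Y P) :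
    ∀ᵐ ω ∂P, ∀ k, 0 < Y k ω := by
  have h0 : lebesgue {0} = 0 := by simpa using lebesgue_Icc 0 0
  have h := hY.count_one (A := Set.univ) MeasurableSet.univ (B := {0})
    (measurableSet_singleton _) (bddAbove_singleton) 0
  simp only [Set.mem_univ, true_and, Set.ofPred_true, Measure.restrict_univ,
    setIntegral_measure_zero _ h0, poissonMeasure_singleton, Nat.cast_zero, Set.encard_eq_zero] at h
  have hset : {ω | {k | Y k ω ∈ ({0} : Set ℝ≥0)} = ∅} = ⋂ k, {ω | 0 < Y k ω} := by
    ext ω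
    simp [Set.eq_empty_iff_forall_notMem, pos_iff_ne_zero]
  rw [hset] at h
  have h1 : ∀ᵐ ω ∂P, ω ∈ ⋂ k, {ω | 0 < Y k ω} := by
    rw [ae_mem_iff_measure_eq (MeasurableSet.iInter fun k =>
      measurableSet_lt measurable_const (hY.measurable k)).nullMeasurableSet, h, measure_univ]
    simp
  filter_upwards [h1] with ω hω using Set.mem_iInter.1 hω

/-- On the event that the intensity at time `t` is at most `x`, it is unlikely that there are many
points before `t`. -/
theorem IsCoxPoints.measure_le_and_le_le [IsProbabilityMeasure P] (hY : IsCoxPoints τ Y P)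
    (hm : ∀ t, Measurable (τ t)) (hc : ∀ᵐ ω ∂P, IsCadlag fun t => τ t ω)
    (hmono : ∀ᵐ ω ∂P, Monotone fun t => τ t ω) (h0 : ∀ᵐ ω ∂P, ∀ t, 0 ≤ τ t ω)
    (t : ℝ≥0) (x : ℝ) (K : ℕ) :
    P {ω | τ t ω ≤ x ∧ Y K ω ≤ t} ≤ ENNReal.ofReal (t * x / (K + 1)) := by
  set A : Set (ℝ≥0 → ℝ) := {f | f t ≤ x} with hA
  have hAm : MeasurableSet A := measurableSet_le (measurable_pi_apply t) measurable_const
  have hAm' : MeasurableSet {ω | (fun t => τ t ω) ∈ A} :=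
    measurableSet_le (hm t) measurable_const
  set s : ℕ → Set Ω := fun m => {ω | (fun t => τ t ω) ∈ A ∧ {k | Y k ω ∈ Set.Iic t}.encard = m}
    with hs
  -- With indices starting at `0`, `Y K ≤ t` means at least `K + 1` points up to `t`.
  have hsub : ({ω | τ t ω ≤ x ∧ Y K ω ≤ t} : Set Ω) ≤ᵐ[P] ⋃ m, s (m + K + 1) := by
    filter_upwards [hY.strictMono, hY.ae_exists_lt hm hc t] with ω h1 h2 h3
    classical
    have h4 := (encard_le_eq_iff h1 t (Nat.find h2)).2
      ⟨Nat.find_spec h2, fun k hk => not_lt.1 (Nat.find_min h2 hk)⟩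
    have h5 : K + 1 ≤ Nat.find h2 := by
      by_contra! h6
      exact absurd ((Nat.find_spec h2).trans_le (h1.monotone (Nat.lt_succ_iff.1 h6)))
        (not_lt.2 h3.2)
    refine Set.mem_iUnion.2 ⟨Nat.find h2 - (K + 1), h3.1, ?_⟩
    rw [h4]
    congr 1
    omega
  have hstep : ∀ m, P (s (m + K + 1)) ≤ ENNReal.ofReal (t * x / (K + 1)) * P (s (m + K)) := by
    intro m
    simp only [hs]
    rw [hY.count_one hAm measurableSet_Iic bddAbove_Iic,
      hY.count_one hAm measurableSet_Iic bddAbove_Iic,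
      ← lintegral_const_mul'' _ (aemeasurable_poissonMeasure hm hc bddAbove_Iic _).restrict]
    refine setLIntegral_mono_ae' hAm' ?_
    filter_upwards [hmono, h0] with ω h1 h2 h3
    refine poissonMeasure_succ_le ?_ (Nat.le_add_left _ _)
    rw [Real.coe_toNNReal _ (integral_nonneg h2)]
    exact (setIntegral_Iic_le h1 h2 t).trans (mul_le_mul_of_nonneg_left h3 t.2)
  calc P {ω | τ t ω ≤ x ∧ Y K ω ≤ t} ≤ P (⋃ m, s (m + K + 1)) := measure_mono_ae hsub
    _ ≤ ∑' m, P (s (m + K + 1)) := measure_iUnion_le _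
    _ ≤ ∑' m, ENNReal.ofReal (t * x / (K + 1)) * P (s (m + K)) := ENNReal.tsum_le_tsum hstep
    _ = ENNReal.ofReal (t * x / (K + 1)) * ∑' m, P (s (m + K)) := ENNReal.tsum_mul_left
    _ ≤ ENNReal.ofReal (t * x / (K + 1)) * ∑' m, P (s m) := by
        refine mul_le_mul_right ?_ _
        exact ENNReal.tsum_comp_le_tsum_of_injective (add_left_injective K) fun m => P (s m)
    _ ≤ ENNReal.ofReal (t * x / (K + 1)) * 1 := by
        gcongr
        rw [hY.tsum_measure_count hm hc hAm measurableSet_Iic bddAbove_Iic]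
        exact prob_le_one
    _ = ENNReal.ofReal (t * x / (K + 1)) := mul_one _

/-- When the intensity is at least `x`, long intervals without points are unlikely. -/
theorem IsCoxPoints.measure_gap_le [IsProbabilityMeasure P] (hY : IsCoxPoints τ Y P)
    (hm : ∀ t, Measurable (τ t))
    (hmono : ∀ᵐ ω ∂P, Monotone fun t => τ t ω) (h0 : ∀ᵐ ω ∂P, ∀ t, 0 ≤ τ t ω)
    (s d : ℝ≥0) (x : ℝ) :
    P {ω | x ≤ τ s ω ∧ ∀ k, Y k ω ∉ Set.Ico s (s + d)} ≤ ENNReal.ofReal (Real.exp (-(d * x))) := by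
  set A : Set (ℝ≥0 → ℝ) := {f | x ≤ f s} with hA
  have hAm : MeasurableSet A := measurableSet_le measurable_const (measurable_pi_apply s)
  have hAm' : MeasurableSet {ω | (fun t => τ t ω) ∈ A} :=
    measurableSet_le measurable_const (hm s)
  have hsub : {ω | x ≤ τ s ω ∧ ∀ k, Y k ω ∉ Set.Ico s (s + d)} ⊆
      {ω | (fun t => τ t ω) ∈ A ∧ {k | Y k ω ∈ Set.Ico s (s + d)}.encard = (0 : ℕ)} := by
    rintro ω ⟨h1, h2⟩
    refine ⟨h1, ?_⟩
    rw [Nat.cast_zero, Set.encard_eq_zero]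
    exact Set.eq_empty_of_forall_notMem h2
  refine (measure_mono hsub).trans ?_
  rw [hY.count_one hAm measurableSet_Ico bddAbove_Ico]
  calc _ ≤ ∫⁻ _ in {ω | (fun t => τ t ω) ∈ A}, ENNReal.ofReal (Real.exp (-(d * x))) ∂P := by
        refine setLIntegral_mono_ae' hAm' ?_
        filter_upwards [hmono, h0] with ω h1 h2 h3
        rw [poissonMeasure_singleton]
        refine ENNReal.ofReal_le_ofReal ?_
        rw [Real.coe_toNNReal _ (integral_nonneg h2)]
        simp only [pow_zero, mul_one, Nat.factorial_zero, Nat.cast_one, div_one]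
        refine Real.exp_le_exp.2 (neg_le_neg ?_)
        exact (mul_le_mul_of_nonneg_left h3 d.2).trans (le_setIntegral_Ico h1 h2 s d)
    _ ≤ ENNReal.ofReal (Real.exp (-(d * x))) := by
        rw [setLIntegral_const]
        exact mul_le_of_le_one_right' prob_le_one

end Points

/-! ### Growth of the intensity, number of points and gaps -/

section Growth

open Filter

variable {Ω Ω' : Type*} [MeasurableSpace Ω] [MeasurableSpace Ω'] {α : ℝ} {p : ℝ → ℝ}
  {P' : Measure Ω'} {σ : ℝ≥0 → Ω' → ℝ} {P : Measure Ω} {τ : ℝ≥0 → Ω → ℝ} {Y : ℕ → Ω → ℝ≥0}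

theorem summable_const_mul_exp_neg (c : ℝ) : Summable fun n : ℕ => c * Real.exp (-n) := by
  have h := (summable_geometric_of_lt_one (Real.exp_pos (-1)).le
    (Real.exp_lt_one_iff.2 (by norm_num : (-1 : ℝ) < 0))).mul_left c
  refine h.congr fun n => ?_
  rw [← Real.exp_nat_mul]
  congr 2
  ring

theorem le_two_pow_mul {C : ℕ} (hC : 1 ≤ C) (n : ℕ) : (n : ℝ) ≤ 2 ^ (C * n) := by
  have h1 : n ≤ 2 ^ (C * n) :=
    Nat.lt_two_pow_self.le.trans (Nat.pow_le_pow_right (by norm_num) (Nat.le_mul_of_pos_left n hC))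
  exact_mod_cast h1

/-- The intensity process grows at least and at most polynomially, along a geometric sequence of
times. -/
theorem IsMeasureChange.exists_growth [IsProbabilityMeasure P] (hτ : IsMeasureChange p σ P' τ P)
    (hσ : IsStableSubordinator α σ P') [IsProbabilityMeasure P'] (hp : IsStableDensity α p)
    (hα₁ : 1 < α) (hα₂ : α < 2) :
    ∃ C : ℕ, ∀ᵐ ω ∂P, ∀ᶠ n : ℕ in atTop,
      4 ^ (n + 1) < τ (2 ^ (C * n)) ω ∧ τ (2 ^ (C * n)) ω ≤ (2 ^ (C * n)) ^ 3 := by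
  obtain ⟨K, D, hD, hlow, hupp⟩ := hτ.exists_measure_le hσ hp hα₁ hα₂
  -- With `t = 2 ^ (C n)`, this makes `t ^ (α - 1) ≥ 8 ^ n`, which dominates the target `4 ^ (n +
  -- 1)`.
  obtain ⟨C, hC⟩ := exists_nat_ge (3 / (α - 1))
  have hβ : 0 < α - 1 := by linarith
  have hC3 : 3 ≤ C * (α - 1) := (div_le_iff₀ hβ).1 hC
  have hC1 : 1 ≤ C := by
    by_contra! h
    have : C = 0 := by omega
    rw [this] at hC3
    norm_num at hC3
  have htend : Tendsto (fun n : ℕ => (2 : ℝ) ^ (C * n)) atTop atTop :=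
    tendsto_atTop_mono (le_two_pow_mul hC1) tendsto_natCast_atTop_atTop
  have hpow8 : ∀ n : ℕ, (8 : ℝ) ^ n ≤ ((2 : ℝ) ^ (C * n)) ^ (α - 1) := by
    intro n
    have h1 : (8 : ℝ) ^ n = (2 : ℝ) ^ (3 * n : ℝ) := by
      rw [Real.rpow_mul (by norm_num), Real.rpow_natCast]
      norm_num
    have h2 : ((2 : ℝ) ^ (C * n)) ^ (α - 1) = (2 : ℝ) ^ ((C * (α - 1)) * n : ℝ) := by
      rw [← Real.rpow_natCast 2 (C * n), ← Real.rpow_mul (by norm_num)]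
      congr 1
      push_cast
      ring
    rw [h1, h2]
    refine Real.rpow_le_rpow_of_exponent_le (by norm_num) ?_
    exact mul_le_mul_of_nonneg_right hC3 (Nat.cast_nonneg _)
  have e1 : ∀ᵐ ω ∂P, ∀ᶠ n : ℕ in atTop, ω ∉ {ω | τ (2 ^ (C * n)) ω ≤ 4 ^ (n + 1)} := by
    refine ae_eventually_notMem_of_summable (summable_const_mul_exp_neg D) ?_
    filter_upwards [eventually_ge_atTop 4] with n hn
    refine (hlow _ _ (by positivity)).trans (ENNReal.ofReal_le_ofReal ?_)
    refine mul_le_mul_of_nonneg_left (Real.exp_le_exp.2 ?_) hD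
    have h1 := hpow8 n
    have h2 := le_two_pow_mul hC1 n
    push_cast
    set t : ℝ := 2 ^ (C * n) with ht
    have h16 : (16 : ℝ) ≤ 2 ^ n := by
      have : (2 : ℝ) ^ 4 ≤ 2 ^ n := pow_le_pow_right₀ (by norm_num) hn
      linarith
    have h3 : (16 : ℝ) * 4 ^ n ≤ 8 ^ n := by
      have : (8 : ℝ) ^ n = 2 ^ n * 4 ^ n := by rw [← mul_pow]; norm_num
      rw [this]
      gcongr
    have h4 : (1 : ℝ) ≤ 4 ^ n := one_le_pow₀ (by norm_num)
    have ht0 : 0 ≤ t := by positivity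
    have h5 : t ^ (α - 1) ≤ α * t ^ (α - 1) :=
      le_mul_of_one_le_left (Real.rpow_nonneg ht0 _) hα₁.le
    have h6 : 2 * t * 4 ^ (n + 1) - t * α * t ^ (α - 1) ≤ t * (-1) := by
      have : 2 * t * 4 ^ (n + 1) - t * α * t ^ (α - 1) =
          t * (8 * 4 ^ n - α * t ^ (α - 1)) := by ring
      rw [this]
      exact mul_le_mul_of_nonneg_left (by linarith) ht0
    linarith
  -- The threshold `t ^ 3` beats the quadratic exponent `K (t + 1) ^ 2` of the upper tail.
  have e2 : ∀ᵐ ω ∂P, ∀ᶠ n : ℕ in atTop,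
      ω ∉ {ω | ((2 : ℝ) ^ (C * n)) ^ 3 < τ (2 ^ (C * n)) ω} := by
    refine ae_eventually_notMem_of_summable (summable_const_mul_exp_neg D) ?_
    filter_upwards [htend.eventually_ge_atTop (4 * |K| + 1)] with n hn
    refine (hupp _ _).trans (ENNReal.ofReal_le_ofReal ?_)
    refine mul_le_mul_of_nonneg_left (Real.exp_le_exp.2 ?_) hD
    have h2 := le_two_pow_mul hC1 n
    push_cast
    set t : ℝ := 2 ^ (C * n) with ht
    have hK0 := abs_nonneg K
    have ht1 : 1 ≤ t := by linarith
    have h3 : K * (t + 1) ^ 2 ≤ |K| * (4 * t ^ 2) := by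
      refine mul_le_mul (le_abs_self K) ?_ (by positivity) hK0
      nlinarith
    have h4 : (4 * |K| + 1) * t ^ 2 ≤ t * t ^ 2 := mul_le_mul_of_nonneg_right hn (by positivity)
    have h5 : t ≤ t ^ 2 := le_self_pow₀ ht1 two_ne_zero
    have h6 : t * t ^ 2 = t ^ 3 := by ring
    linarith
  refine ⟨C, ?_⟩
  filter_upwards [e1, e2] with ω h1 h2
  filter_upwards [h1, h2] with n h3 h4
  exact ⟨not_le.1 h3, not_lt.1 h4⟩

/-- The bound `exp x ≥ x ^ (C + 2) / (C + 2)!` at `x = 2 ^ n` beats the number of grid cells by a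
factor `2 ^ n`. This serves the union bound over empty cells. -/
theorem summable_mul_exp_neg_two_pow (C : ℕ) :
    Summable fun n : ℕ => (2 * 2 ^ ((C + 1) * n) + 1) * Real.exp (-2 ^ n) := by
  refine Summable.of_nonneg_of_le (fun n => by positivity) (fun n => ?_)
    ((summable_geometric_of_lt_one (r := (1 / 2 : ℝ)) (by norm_num) (by norm_num)).mul_left
      (3 * ((C + 2).factorial : ℝ)))
  have h1 := Real.pow_div_factorial_le_exp (x := (2 : ℝ) ^ n) (by positivity) (C + 2)
  have h2 : (1 : ℝ) ≤ 2 ^ ((C + 1) * n) := one_le_pow₀ (by norm_num)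
  have h3 : ((2 : ℝ) ^ n) ^ (C + 2) = 2 ^ ((C + 1) * n) * 2 ^ n := by
    rw [← pow_mul, ← pow_add]
    congr 1
    ring
  rw [h3] at h1
  rw [Real.exp_neg]
  rw [div_le_iff₀ (by positivity)] at h1
  rw [one_div, inv_pow, ← div_eq_mul_inv, ← div_eq_mul_inv, div_le_div_iff₀ (Real.exp_pos _)
    (by positivity)]
  have h4 : (0 : ℝ) < 2 ^ n := by positivity
  nlinarith

/-- Almost surely, few points have a small intensity, and the distance from a point to the next
one is small where the intensity is large. -/
theorem IsCoxPoints.ae_eventually_count_and_gap [IsProbabilityMeasure P] (hY : IsCoxPoints τ Y P)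
    (hm : ∀ t, Measurable (τ t)) (hc : ∀ᵐ ω ∂P, IsCadlag fun t => τ t ω)
    (hmono : ∀ᵐ ω ∂P, Monotone fun t => τ t ω) (h0 : ∀ᵐ ω ∂P, ∀ t, 0 ≤ τ t ω) {C : ℕ}
    (hC : ∀ᵐ ω ∂P, ∀ᶠ n : ℕ in atTop,
      4 ^ (n + 1) < τ (2 ^ (C * n)) ω ∧ τ (2 ^ (C * n)) ω ≤ (2 ^ (C * n)) ^ 3) :
    ∀ᵐ ω ∂P, ∀ᶠ n : ℕ in atTop, ∀ k,
      Function.leftLim (fun t => τ t ω) (Y k ω) < 4 ^ (n + 1) →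
        k < 2 ^ ((4 * C + 1) * n) ∧
        (4 ^ n ≤ Function.leftLim (fun t => τ t ω) (Y k ω) →
          (Y (k + 1) ω : ℝ) - Y k ω ≤ 2 * (1 / 2) ^ n) := by
  -- At time `t = 2 ^ (C n)` the integrated intensity is at most `t * t ^ 3 = 2 ^ (4 C n)`; the
  -- extra factor `2 ^ n` in the index makes the probabilities summable.
  have e1 : ∀ᵐ ω ∂P, ∀ᶠ n : ℕ in atTop, ω ∉ {ω | τ (2 ^ (C * n)) ω ≤ (2 ^ (C * n)) ^ 3 ∧
      Y (2 ^ ((4 * C + 1) * n)) ω ≤ 2 ^ (C * n)} := by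
    refine ae_eventually_notMem_of_summable
      (summable_geometric_of_lt_one (r := (1 / 2 : ℝ)) (by norm_num) (by norm_num))
      (Eventually.of_forall fun n => ?_)
    refine (hY.measure_le_and_le_le hm hc hmono h0 _ _ _).trans (ENNReal.ofReal_le_ofReal ?_)
    push_cast
    have h1 : (2 : ℝ) ^ (C * n) * (2 ^ (C * n)) ^ 3 = 2 ^ (4 * C * n) := by
      rw [← pow_mul, ← pow_add]
      congr 1
      ring
    have h2 : (2 : ℝ) ^ ((4 * C + 1) * n) = 2 ^ (4 * C * n) * 2 ^ n := by
      rw [← pow_add]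
      congr 1
      ring
    rw [h1, h2, div_le_iff₀ (by positivity), mul_add, mul_left_comm, ← mul_pow]
    norm_num
  -- A cell of length `2 ^ (-n)` with intensity at least `4 ^ n` has mass at least `2 ^ n`, so it is
  -- empty with probability at most `exp (-2 ^ n)`.
  have e2 : ∀ᵐ ω ∂P, ∀ᶠ n : ℕ in atTop, ω ∉ ⋃ i ∈ Finset.range (2 * 2 ^ ((C + 1) * n) + 1),
      {ω | 4 ^ n ≤ τ ((i : ℝ≥0) / 2 ^ n) ω ∧
        ∀ k, Y k ω ∉ Set.Ico ((i : ℝ≥0) / 2 ^ n) ((i : ℝ≥0) / 2 ^ n + 1 / 2 ^ n)} := by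
    refine ae_eventually_notMem_of_summable (summable_mul_exp_neg_two_pow C)
      (Eventually.of_forall fun n => ?_)
    refine (measure_biUnion_finset_le _ _).trans ((Finset.sum_le_sum fun i _ =>
      hY.measure_gap_le hm hmono h0 _ _ _).trans ?_)
    rw [Finset.sum_const, Finset.card_range, nsmul_eq_mul, ENNReal.ofReal_mul (by positivity)]
    refine mul_le_mul' ?_ (ENNReal.ofReal_le_ofReal (Real.exp_le_exp.2 (neg_le_neg ?_)))
    · rw [← ENNReal.ofReal_natCast]
      push_cast
      exact le_rfl
    · push_cast
      rw [div_mul_eq_mul_div, one_mul, ← div_pow]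
      norm_num
  filter_upwards [hC, e1, e2, hmono, hY.strictMono] with ω h1 h2 h3 hmω hYω
  filter_upwards [h1, h2, h3] with n h4 h5 h6 k hk
  have hYt : Y k ω ≤ 2 ^ (C * n) := by
    by_contra! h
    have := hmω.le_leftLim h
    linarith [h4.1]
  refine ⟨?_, fun hk' => ?_⟩
  · by_contra! h
    exact h5 ⟨h4.2, (hYω.monotone h).trans hYt⟩
  -- The first grid cell after `Y k` still has intensity at least `4 ^ n`, hence contains a point.
  -- The next point is thus within two mesh lengths.
  · set i := ⌊Y k ω * 2 ^ n⌋₊ + 1 with hi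
    have hpos : (0 : ℝ≥0) < 2 ^ n := by positivity
    have hi1 : Y k ω < (i : ℝ≥0) / 2 ^ n := by
      rw [lt_div_iff₀ hpos, hi]
      push_cast
      exact Nat.lt_floor_add_one _
    have hi2 : (i : ℝ≥0) / 2 ^ n ≤ Y k ω + 1 / 2 ^ n := by
      rw [div_le_iff₀ hpos, add_mul, one_div, inv_mul_cancel₀ hpos.ne', hi]
      push_cast
      gcongr
      exact Nat.floor_le zero_le
    have hi3 : i < 2 * 2 ^ ((C + 1) * n) + 1 := by
      have h7 : ⌊Y k ω * 2 ^ n⌋₊ ≤ 2 ^ ((C + 1) * n) := by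
        refine Nat.floor_le_of_le ?_
        have h8 : (2 : ℝ≥0) ^ ((C + 1) * n) = 2 ^ (C * n) * 2 ^ n := by
          rw [← pow_add]
          congr 1
          ring
        push_cast
        rw [h8]
        gcongr
      have h9 : 1 ≤ 2 ^ ((C + 1) * n) := Nat.one_le_two_pow
      omega
    have h10 : ∃ l, Y l ω ∈ Set.Ico ((i : ℝ≥0) / 2 ^ n) ((i : ℝ≥0) / 2 ^ n + 1 / 2 ^ n) := by
      by_contra! h
      exact h6 (Set.mem_biUnion (Finset.mem_range.2 hi3) ⟨hk'.trans (hmω.leftLim_le hi1.le), h⟩)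
    obtain ⟨l, hl1, hl2⟩ := h10
    have hkl : k < l := hYω.lt_iff_lt.1 (hi1.trans_le hl1)
    have h11 : Y (k + 1) ω ≤ Y l ω := hYω.monotone hkl
    have h12 : Y (k + 1) ω ≤ Y k ω + 1 / 2 ^ n + 1 / 2 ^ n :=
      h11.trans (hl2.le.trans (by gcongr))
    have h13 : (Y (k + 1) ω : ℝ) ≤ Y k ω + 1 / 2 ^ n + 1 / 2 ^ n := by exact_mod_cast h12
    rw [one_div_pow]
    linarith

end Growth

/-! ### Attachment points, independence and conclusion -/

section Assembly

open Filter

/-- The left limits of the path `g.1` at the points `g.2`, as suprema. -/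
noncomputable def leftValue (g : (ℝ≥0 → ℝ) × (ℕ → ℝ≥0)) (k : ℕ) : ℝ≥0∞ :=
  ⨆ q : ℚ, {s | s < g.2 k}.indicator (fun _ => ENNReal.ofReal (g.1 (ratTime q))) (ratTime q)

/-- The right limits of the path `g.1` at the points `g.2`, as infima. -/
noncomputable def rightValue (g : (ℝ≥0 → ℝ) × (ℕ → ℝ≥0)) (k : ℕ) : ℝ≥0∞ :=
  ⨅ q : ℚ, ENNReal.ofReal (g.1 (ratTime q)) +
    {s | s ≤ g.2 k}.indicator (fun _ => ∞) (ratTime q)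

/-- Evaluation of an arbitrary path at a variable time is not measurable for the product σ-algebra,
whereas extrema over rational times are. The values at the points thus become measurable functions
of `(τ, Y)`, and independence from `U` passes to them. -/
theorem measurable_leftValue : Measurable leftValue := by
  refine measurable_pi_lambda _ fun k => Measurable.iSup fun q => ?_
  have h1 : Measurable fun g : (ℝ≥0 → ℝ) × (ℕ → ℝ≥0) => ENNReal.ofReal (g.1 (ratTime q)) :=
    ((measurable_pi_apply (ratTime q)).comp measurable_fst).ennreal_ofReal
  have h2 : MeasurableSet {g : (ℝ≥0 → ℝ) × (ℕ → ℝ≥0) | ratTime q < g.2 k} :=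
    measurableSet_lt measurable_const ((measurable_pi_apply k).comp measurable_snd)
  exact h1.indicator h2

theorem measurable_rightValue : Measurable rightValue := by
  refine measurable_pi_lambda _ fun k => Measurable.iInf fun q => ?_
  have h1 : Measurable fun g : (ℝ≥0 → ℝ) × (ℕ → ℝ≥0) => ENNReal.ofReal (g.1 (ratTime q)) :=
    ((measurable_pi_apply (ratTime q)).comp measurable_fst).ennreal_ofReal
  have h2 : MeasurableSet {g : (ℝ≥0 → ℝ) × (ℕ → ℝ≥0) | ratTime q ≤ g.2 k} :=
    measurableSet_le measurable_const ((measurable_pi_apply k).comp measurable_snd)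
  exact h1.add ((measurable_const (a := (∞ : ℝ≥0∞))).indicator h2)

theorem leftValue_eq {f : ℝ≥0 → ℝ} (hf : Monotone f) {y : ℕ → ℝ≥0} {k : ℕ} (hy : 0 < y k) :
    leftValue (f, y) k = ENNReal.ofReal (Function.leftLim f (y k)) := by
  refine le_antisymm (iSup_le fun q => ?_) ?_
  · by_cases h : ratTime q < y k
    · rw [Set.indicator_of_mem (s := {s | s < y k}) h]
      exact ENNReal.ofReal_le_ofReal (hf.le_leftLim h)
    · rw [Set.indicator_of_notMem (s := {s | s < y k}) h]
      exact zero_le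
  · have hne : (nhdsWithin (y k) (Set.Iio (y k))).NeBot := nhdsLT_neBot_of_exists_lt ⟨0, hy⟩
    have ht := (ENNReal.continuous_ofReal.tendsto _).comp (hf.tendsto_leftLim (y k))
    refine le_of_tendsto ht ?_
    filter_upwards [self_mem_nhdsWithin] with s hs
    obtain ⟨q, hq1, hq2⟩ := exists_ratTime_between (show s < y k from hs)
    refine le_iSup_of_le q ?_
    rw [Set.indicator_of_mem (s := {s | s < y k}) hq2]
    exact ENNReal.ofReal_le_ofReal (hf hq1.le)

theorem rightValue_eq {f : ℝ≥0 → ℝ} (hf : Monotone f) (hc : IsCadlag f) {y : ℕ → ℝ≥0} {k : ℕ} :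
    rightValue (f, y) k = ENNReal.ofReal (f (y k)) := by
  refine le_antisymm ?_ (le_iInf fun q => ?_)
  · have ht := (ENNReal.continuous_ofReal.tendsto _).comp
      (((hc (y k)).1.mono Set.Ioi_subset_Ici_self).tendsto)
    refine ge_of_tendsto ht ?_
    filter_upwards [self_mem_nhdsWithin] with s hs
    obtain ⟨q, hq1, hq2⟩ := exists_ratTime_between (show y k < s from hs)
    refine iInf_le_of_le q ?_
    rw [Set.indicator_of_notMem (s := {s | s ≤ y k}) (not_le.2 hq1), add_zero]
    exact ENNReal.ofReal_le_ofReal (hf hq2.le)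
  · by_cases h : ratTime q ≤ y k
    · rw [Set.indicator_of_mem (s := {s | s ≤ y k}) h, add_top]
      exact le_top
    · rw [Set.indicator_of_notMem (s := {s | s ≤ y k}) h, add_zero]
      exact ENNReal.ofReal_le_ofReal (hf (not_le.1 h).le)

section Path

variable {f : ℝ≥0 → ℝ} {v : ℝ≥0} {u : ℝ}

theorem leftLim_pos (hf : Monotone f) (hpos : ∀ t, 0 < t → 0 < f t) (hv : 0 < v) :
    0 < Function.leftLim f v := by
  obtain ⟨s, hs0, hs⟩ := exists_between hv
  exact (hpos s hs0).trans_le (hf.le_leftLim hs)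

/-- The left limit is positive and `u < 1`, so the path exceeds the threshold before `v`. This gives
`Z_k < Y_k` and shows that the set defining `Z_k` is nonempty. -/
theorem exists_lt_mul_leftLim_lt (hf : Monotone f) (hpos : ∀ t, 0 < t → 0 < f t) (hv : 0 < v)
    (hu : u < 1) : ∃ s < v, 0 < s ∧ u * Function.leftLim f v < f s := by
  have hX := leftLim_pos hf hpos hv
  have hne : (nhdsWithin v (Set.Iio v)).NeBot := nhdsLT_neBot_of_exists_lt ⟨0, hv⟩
  have h1 : ∀ᶠ s in nhdsWithin v (Set.Iio v), u * Function.leftLim f v < f s :=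
    (hf.tendsto_leftLim v).eventually (lt_mem_nhds (mul_lt_of_lt_one_left hX hu))
  have h2 : ∀ᶠ s in nhdsWithin v (Set.Iio v), 0 < s :=
    nhdsWithin_le_nhds (lt_mem_nhds hv)
  have h3 : ∀ᶠ s in nhdsWithin v (Set.Iio v), s < v := self_mem_nhdsWithin
  obtain ⟨s, h4, h5, h6⟩ := (h1.and (h2.and h3)).exists
  exact ⟨s, h6, h5, h4⟩

theorem sInf_le_of_lt {c : ℝ} {w : ℝ≥0} (hw : 0 < w) (h : c < f w) :
    sInf {t | 0 < t ∧ c < f t} ≤ w :=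
  csInf_le (OrderBot.bddBelow _) ⟨hw, h⟩

/-- Right-continuity keeps `f` below `c` just after `w`, so the infimum is strictly larger.
Nonemptiness matters because `sInf ∅ = 0`. -/
theorem lt_sInf_of_lt {c : ℝ} (hf : Monotone f) (hc : IsCadlag f) {w : ℝ≥0} (hw : f w < c)
    (hne : {t | 0 < t ∧ c < f t}.Nonempty) : w < sInf {t | 0 < t ∧ c < f t} := by
  have h1 : ∀ᶠ s in nhdsWithin w (Set.Ioi w), f s < c :=
    ((hc w).1.mono Set.Ioi_subset_Ici_self).eventually (gt_mem_nhds hw)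
  obtain ⟨b, hb, hb'⟩ := mem_nhdsGT_iff_exists_Ioo_subset.1 h1
  refine lt_of_lt_of_le hb (le_csInf hne fun t ht => ?_)
  by_contra! htb
  rcases le_or_gt t w with h | h
  · exact lt_asymm ht.2 ((hf h).trans_lt hw)
  · exact lt_asymm ht.2 (hb' ⟨h, htb⟩)

end Path

/-- The number of generations is logarithmic in the index and the index exponential in the level, so
the terms are `O(n 2 ^ (-n))`. -/
theorem summable_log_mul_geometric (E : ℕ) :
    Summable fun n : ℕ =>
      ((2 * (Nat.log 2 (2 ^ (E * n) + 1) + 1) : ℕ) : ℝ) * (2 * (1 / 2) ^ n) := by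
  have h1 : Summable fun n : ℕ => (n : ℝ) ^ 1 * (1 / 2 : ℝ) ^ n :=
    summable_pow_mul_geometric_of_norm_lt_one 1 (by norm_num)
  have h2 : Summable fun n : ℕ => (1 / 2 : ℝ) ^ n :=
    summable_geometric_of_lt_one (by norm_num) (by norm_num)
  refine Summable.of_nonneg_of_le (fun n => by positivity) (fun n => ?_)
    ((h1.mul_left (4 * (E : ℝ))).add (h2.mul_left 8))
  have h3 : Nat.log 2 (2 ^ (E * n) + 1) + 1 ≤ E * n + 2 := by
    have : Nat.log 2 (2 ^ (E * n) + 1) < E * n + 2 := by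
      refine Nat.log_lt_of_lt_pow (by positivity) ?_
      have := Nat.one_le_two_pow (n := E * n)
      rw [pow_add]
      omega
    omega
  have h4 : ((2 * (Nat.log 2 (2 ^ (E * n) + 1) + 1) : ℕ) : ℝ) ≤ 2 * (E * n + 2) := by
    exact_mod_cast Nat.mul_le_mul_left 2 h3
  refine (mul_le_mul_of_nonneg_right h4 (by positivity)).trans (le_of_eq ?_)
  ring

/-- The factor `2` in the exponent gives terms of at most `(k + 1) ^ (-2)`. -/
theorem tsum_inv_two_pow_log_ne_top :
    ∑' k : ℕ, (2⁻¹ : ℝ≥0∞) ^ (2 * (Nat.log 2 (k + 1) + 1)) ≠ ∞ := by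
  have h1 : Summable fun k : ℕ => 1 / ((k + 1 : ℕ) : ℝ) ^ 2 :=
    (summable_nat_add_iff 1).2 (Real.summable_one_div_nat_pow.2 one_lt_two)
  refine ne_top_of_le_ne_top h1.tsum_ofReal_ne_top (ENNReal.tsum_le_tsum fun k => ?_)
  have h2 : ((k + 1 : ℕ) : ℝ) ≤ 2 ^ (Nat.log 2 (k + 1) + 1) := by
    exact_mod_cast (Nat.lt_pow_succ_log_self one_lt_two (k + 1)).le
  have h3 : (2⁻¹ : ℝ≥0∞) = ENNReal.ofReal 2⁻¹ := by
    rw [ENNReal.ofReal_inv_of_pos two_pos]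
    norm_num
  rw [h3, ← ENNReal.ofReal_pow (by norm_num), inv_pow, mul_comm 2, pow_mul, one_div]
  refine ENNReal.ofReal_le_ofReal (inv_anti₀ (by positivity) ?_)
  gcongr

variable {Ω : Type*} [MeasurableSpace Ω] {P : Measure Ω} {U : Ω → ℝ}

theorem lintegral_ofReal_of_uniform (hm : Measurable U)
    (hU : P.map U = volume.restrict (Set.Icc (0 : ℝ) 1)) :
    ∫⁻ ω, ENNReal.ofReal (U ω) ∂P = 2⁻¹ := by
  rw [← lintegral_map (f := ENNReal.ofReal) ENNReal.measurable_ofReal hm, hU,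
    ← ofReal_integral_eq_lintegral_ofReal]
  · rw [integral_Icc_eq_integral_Ioc, ← intervalIntegral.integral_of_le zero_le_one, integral_id]
    norm_num
    rw [one_div, ENNReal.ofReal_inv_of_pos two_pos]
    norm_num
  · exact continuous_id.integrableOn_Icc
  · filter_upwards [ae_restrict_mem measurableSet_Icc] with x hx using hx.1

theorem measure_eq_zero_of_uniform (hm : Measurable U)
    (hU : P.map U = volume.restrict (Set.Icc (0 : ℝ) 1)) (c : ℝ) : P {ω | U ω = c} = 0 := by
  have h : P {ω | U ω = c} = P.map U {c} := by
    rw [Measure.map_apply hm (measurableSet_singleton c)]; rfl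
  rw [h, hU]
  simp

theorem ae_mem_Ioo_of_uniform (hm : Measurable U)
    (hU : P.map U = volume.restrict (Set.Icc (0 : ℝ) 1)) : ∀ᵐ ω ∂P, 0 < U ω ∧ U ω < 1 := by
  have h1 : ∀ᵐ x ∂(P.map U), x ∈ Set.Icc (0 : ℝ) 1 := by
    rw [hU]
    exact ae_restrict_mem measurableSet_Icc
  have h2 : ∀ c, ∀ᵐ ω ∂P, U ω ≠ c := fun c => by
    rw [ae_iff]
    simpa using measure_eq_zero_of_uniform hm hU c
  filter_upwards [ae_of_ae_map hm.aemeasurable h1, h2 0, h2 1] with ω h3 h4 h5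
  exact ⟨lt_of_le_of_ne h3.1 (Ne.symm h4), lt_of_le_of_ne h3.2 h5⟩

theorem measure_ofReal_eq_zero_of_uniform (hm : Measurable U)
    (hU : P.map U = volume.restrict (Set.Icc (0 : ℝ) 1)) (c : ℝ≥0∞) :
    P {ω | ENNReal.ofReal (U ω) = c} = 0 := by
  have h : ∀ᵐ ω ∂P, ENNReal.ofReal (U ω) ≠ c := by
    have h2 : ∀ᵐ ω ∂P, U ω ≠ c.toReal := by
      rw [ae_iff]
      simpa using measure_eq_zero_of_uniform hm hU c.toReal
    filter_upwards [ae_mem_Ioo_of_uniform hm hU, h2] with ω h3 h4 h5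
    exact h4 (by rw [← h5, ENNReal.toReal_ofReal h3.1.le])
  rw [ae_iff] at h
  simpa using h

/-- The line-breaking tree driven by the tilted stable subordinator is almost surely well defined
and compact. -/
theorem ae_compactSpace_tree {α : ℝ} (hα₁ : 1 < α) (hα₂ : α < 2)
    {p : ℝ → ℝ} (hp : IsStableDensity α p)
    {Ω' : Type*} [MeasurableSpace Ω'] {P' : Measure Ω'} [IsProbabilityMeasure P']
    {σ : ℝ≥0 → Ω' → ℝ} (hσ : IsStableSubordinator α σ P')
    {Ω : Type*} [MeasurableSpace Ω] {P : Measure Ω} [IsProbabilityMeasure P]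
    {τ : ℝ≥0 → Ω → ℝ} (hτ : IsMeasureChange p σ P' τ P)
    {Y : ℕ → Ω → ℝ≥0} {U : ℕ → Ω → ℝ} (hYU : IsLineBreakingInput τ Y U P) :
    ∀ᵐ ω ∂P,
      ∃ h : IsCutAttach (fun k => Y k ω)
          (fun k => attach τ Y U k ω),
        CompactSpace (Tree h) := by
  have hY := hYU.cuts
  have hmono := hτ.ae_monotone hσ
  have hnonneg := hτ.ae_nonneg hσ
  obtain ⟨C, hC⟩ := hτ.exists_growth hσ hp hα₁ hα₂
  set V : ℕ → Ω → ℝ≥0∞ := fun k ω => ENNReal.ofReal (U k ω)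
  set x : Ω → ℕ → ℝ≥0∞ := fun ω => leftValue ((fun t => τ t ω), fun k => Y k ω)
  set r : Ω → ℕ → ℝ≥0∞ := fun ω => rightValue ((fun t => τ t ω), fun k => Y k ω)
  have hG : Measurable fun ω => ((fun t => τ t ω), fun k => Y k ω) :=
    (measurable_pi_lambda _ hτ.measurable).prodMk (measurable_pi_lambda _ hY.measurable)
  have hVm : ∀ k, Measurable (V k) := fun k => (hYU.measurable_unif k).ennreal_ofReal
  have hVi : iIndepFun V P :=
    hYU.indep_unif.comp (fun _ => ENNReal.ofReal) fun _ => ENNReal.measurable_ofReal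
  have hVmean : ∀ k, ∫⁻ ω, V k ω ∂P ≤ 2⁻¹ := fun k =>
    (lintegral_ofReal_of_uniform (hYU.measurable_unif k) (hYU.law_unif k)).le
  have hVx : IndepFun (fun ω k => V k ω) (fun ω => (x ω, r ω)) P := by
    have h1 : Measurable fun (u : ℕ → ℝ) (k : ℕ) => ENNReal.ofReal (u k) :=
      measurable_pi_lambda _ fun k => (measurable_pi_apply k).ennreal_ofReal
    exact hYU.indep.comp h1 (measurable_leftValue.prodMk measurable_rightValue)
  have hx : Measurable x := measurable_leftValue.comp hG
  have hr : Measurable r := measurable_rightValue.comp hG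
  have hxe : ∀ᵐ ω ∂P, ∀ k,
      x ω k = ENNReal.ofReal (Function.leftLim (fun t => τ t ω) (Y k ω)) := by
    filter_upwards [hmono, hY.ae_pos] with ω h1 h2 k
    exact leftValue_eq h1 (h2 k)
  have hre : ∀ᵐ ω ∂P, ∀ k, r ω k = ENNReal.ofReal (τ (Y k ω) ω) := by
    filter_upwards [hmono, hτ.cadlag] with ω h1 h2 k
    exact rightValue_eq h1 h2
  have hxr : ∀ᵐ ω ∂P, x ω ≤ r ω := by
    filter_upwards [hmono, hxe, hre] with ω h1 h2 h3 k
    rw [h2, h3]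
    exact ENNReal.ofReal_le_ofReal (h1.leftLim_le le_rfl)
  have hxpos : ∀ᵐ ω ∂P, ∀ k, 0 < x ω k ∧ x ω k < ∞ := by
    filter_upwards [hmono, hxe, hτ.ae_pos hσ hα₁, hY.ae_pos] with ω h1 h2 h3 h4 k
    rw [h2]
    exact ⟨ENNReal.ofReal_pos.2 (leftLim_pos h1 h3 (h4 k)), ENNReal.ofReal_lt_top⟩
  have hchain := ae_eventually_ancestorValue_lt hVm hVi hVmean hx hr hVx hxr hxpos
    tsum_inv_two_pow_log_ne_top
  have htie := ae_mul_ne_of_indepFun hVm (fun k c => measure_ofReal_eq_zero_of_uniform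
    (hYU.measurable_unif k) (hYU.law_unif k) c) hx hr hVx hxpos
  have hgap := hY.ae_eventually_count_and_gap hτ.measurable hτ.cadlag hmono hnonneg hC
  have hU : ∀ᵐ ω ∂P, ∀ k, 0 < U k ω ∧ U k ω < 1 := ae_all_iff.2 fun k =>
    ae_mem_Ioo_of_uniform (hYU.measurable_unif k) (hYU.law_unif k)
  filter_upwards [hmono, hτ.cadlag, hτ.ae_pos hσ hα₁, hY.strictMono, hY.ae_pos,
    hY.ae_tendsto hτ.measurable hτ.cadlag, hU, hxe, hre, hchain, htie, hgap]
    with ω hf hcad hpos hYs hYpos hYt hUω hxω hrω hchω htω hgω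
  set f : ℝ≥0 → ℝ := fun t => τ t ω
  have hex := fun k => exists_lt_mul_leftLim_lt hf hpos (hYpos k) (hUω k).2
  have hlt : ∀ k, attach τ Y U k ω < Y k ω := fun k => by
    obtain ⟨s, hs1, hs2, hs3⟩ := hex k
    exact (sInf_le_of_lt (f := f) hs2 hs3).trans_lt hs1
  have h : IsCutAttach (fun k => Y k ω) (fun k => attach τ Y U k ω) := ⟨hYs, hYt, hlt⟩
  have hX0 : ∀ k, 0 ≤ Function.leftLim f (Y k ω) := fun k => (leftLim_pos hf hpos (hYpos k)).le
  have hprod : ∀ k, V k ω * x ω k =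
      ENNReal.ofReal (U k ω * Function.leftLim f (Y k ω)) := fun k => by
    rw [hxω, ENNReal.ofReal_mul (hUω k).1.le]
  have hle : ∀ j k, V k ω * x ω k < r ω j → attach τ Y U k ω ≤ Y j ω := by
    intro j k hjk
    rw [hprod, hrω] at hjk
    exact sInf_le_of_lt (f := f) (hYpos j) ((ENNReal.ofReal_lt_ofReal_iff_of_nonneg
      (mul_nonneg (hUω k).1.le (hX0 k))).1 hjk)
  have hgt : ∀ j k, r ω j ≤ V k ω * x ω k → Y j ω < attach τ Y U k ω := by
    intro j k hjk
    -- Without ties the inequality is strict. If equality held, `Z_k` could coincide with `Y_j` and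
    -- fall outside the open end of the segment.
    have hjk' := lt_of_le_of_ne hjk (htω j k).symm
    rw [hprod, hrω] at hjk'
    obtain ⟨s, -, hs2, hs3⟩ := hex k
    exact lt_sInf_of_lt hf hcad ((ENNReal.ofReal_lt_ofReal_iff_of_nonneg
      (hpos _ (hYpos j)).le).1 hjk') (Set.nonempty_of_mem (x := s) ⟨hs2, hs3⟩)
  have h4 : ∀ n : ℕ, (4 : ℝ≥0∞) ^ n = ENNReal.ofReal (4 ^ n) := fun n => by
    rw [ENNReal.ofReal_pow (by norm_num)]
    norm_num
  have hx4 : ∀ n k, x ω k < 4 ^ n ↔ Function.leftLim f (Y k ω) < 4 ^ n := fun n k => by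
    rw [hxω, h4, ENNReal.ofReal_lt_ofReal_iff_of_nonneg (hX0 k)]
  refine ⟨h, compactSpace_tree h (x := x ω) (a := ancestorValue (fun k => V k ω) (x ω) (r ω))
    (m := fun k => 2 * (Nat.log 2 (k + 1) + 1)) (δ := fun n => 2 * (1 / 2) ^ n)
    (N := fun n => 2 ^ ((4 * C + 1) * n)) (fun k => rfl) ?_ ?_ ?_ ?_ hchω
    (fun n => by positivity) ?_ ?_ (summable_log_mul_geometric _)⟩
  · intro i j hij
    rw [hxω, hxω]
    exact ENNReal.ofReal_le_ofReal (hf.leftLim (hYs.monotone hij))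
  · intro k
    rw [hxω]
    exact ENNReal.ofReal_lt_top
  · intro k
    rcases exists_isParent_or (V k ω) (x ω) (r ω) k with ⟨j, hj⟩ | hno
    · refine Or.inr ⟨j, hj.1, hgt j k hj.2.1, ?_, fun m =>
        ancestorValue_succ_of_isParent (u := fun k => V k ω) hj m⟩
      -- Maximality of the parent `j` gives `Z_k ≤ Y_{j+1}` only if `j + 1 < k`; for `j + 1 = k`
      -- this is `Z_k < Y_k`.
      rcases eq_or_lt_of_le (Nat.succ_le_of_lt hj.1) with hjk | hjk
      · have := hlt k
        rw [← hjk] at this ⊢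
        exact this.le
      · exact hle _ _ (hj.2.2 _ (Nat.lt_succ_self j) hjk)
    · left
      rcases Nat.eq_zero_or_pos k with rfl | hk
      · exact (hlt 0).le
      · exact hle 0 k (hno 0 hk)
  · intro i j hij
    have : Nat.log 2 (i + 1) ≤ Nat.log 2 (j + 1) := Nat.log_mono_right (by omega)
    show 2 * (Nat.log 2 (i + 1) + 1) ≤ 2 * (Nat.log 2 (j + 1) + 1)
    omega
  · filter_upwards [hgω] with n hn k h1 h2
    refine (hn k ((hx4 _ _).1 h2)).2 (not_lt.1 fun h3 => ?_)
    exact absurd ((hx4 n k).2 h3) (not_lt.2 h1)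
  · filter_upwards [hgω] with n hn k h1
    exact (hn k ((hx4 _ _).1 h1)).1

end Assembly

end LineBreaking

theorem theorem2p9 (α : ℝ) (hα₁ : 1 < α) (hα₂ : α < 2)
    (p : ℝ → ℝ) (hp : LineBreaking.IsStableDensity α p)
    {Ω' : Type*} [MeasurableSpace Ω'] (P' : Measure Ω') [IsProbabilityMeasure P']
    (σ : ℝ≥0 → Ω' → ℝ) (hσ : LineBreaking.IsStableSubordinator α σ P')
    {Ω : Type*} [MeasurableSpace Ω] (P : Measure Ω) [IsProbabilityMeasure P]
    (τ : ℝ≥0 → Ω → ℝ) (hτ : LineBreaking.IsMeasureChange p σ P' τ P)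
    (Y : ℕ → Ω → ℝ≥0) (U : ℕ → Ω → ℝ) (hYU : LineBreaking.IsLineBreakingInput τ Y U P) :
    ∀ᵐ ω ∂P,
      ∃ h : LineBreaking.IsCutAttach (fun k => Y k ω)
          (fun k => LineBreaking.attach τ Y U k ω),
        CompactSpace (LineBreaking.Tree h) :=
  LineBreaking.ae_compactSpace_tree hα₁ hα₂ hp hσ hτ hYU
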